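/- **Definitions.** Fix $n\ge 0$. A *Pauli observable* on $n$ qubits is an operator $\pm P_1\otimes\cdots\otimes P_n$ with $P_i\in\{I,X,Y,Z\}$; it *stabilizes* a pure state $|\psi\rangle$ (taken up to a scalar) if $O|\psi\rangle=|\psi\rangle$. A *stabilizer state* is a pure state that is, up to a scalar, the only vector fixed by all Pauli observables that stabilize it. A *Clifford unitary* is a unitary that conjugates Pauli observables to Pauli observables. The *graph state* of a graph $G$ on $k$ qubits is proportional to $\sum_{x\in\{0,1\}^k}(-1)^{e_G(x)}|x\rangle$, where $e_G(x)$ is the number of edges of $G$ with bit $1$ at both ends. Three stabilizer states $\psi_1,\psi_2,\psi_3$ *have stabilizers forming a Mermin–Peres magic square* if there are Pauli observables $A,a,B,b$ with $[A,a]=[B,b]=[A,B]=[a,b]=0$ and $\{A,b\}=\{a,B\}=0$ such that in the table $$\begin{array}{c|ccc}\psi_1&A&a&Aa\\ \psi_2&B&b&Bb\\ \psi_3&AB&ab&ABab\end{array}$$ all entries are Pauli observables, the entries of row $i$ stabilize $\psi_i$, every row has product $+1$, and the columns have products $+1,+1,-1$. An *ontological theory* (for Pauli measurements on $n$-qubit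 stabilizer states) consists of a finite set $\Lambda$ of hidden variables, a probability distribution $p_\psi$ on $\Lambda$ for each stabilizer state $\psi$, outcome probabilities $p(y\mid\lambda,P)$ ($y=\pm1$) for each Pauli string $P\in\{I,X,Y,Z\}^{\otimes n}$, and transition probabilities $\Gamma_{(P,y)}(\lambda'\mid\lambda)$. On the state $\psi$ it assigns to the outcomes $y_1,\dots,y_t$ of successive measurements of $P_1,\dots,P_t$ the probability $$\sum_{\lambda_1,\dots,\lambda_{t+1}}p_\psi(\lambda_1)\prod_{j=1}^t p(y_j\mid\lambda_j,P_j)\,\Gamma_{(P_j,y_j)}(\lambda_{j+1}\mid\lambda_j).$$ It *simulates* the measurements if, for every stabilizer state $\psi$ and every finite sequence of Pauli measurements and outcomes, this probability is zero if and only if the quantum mechanical probability of these outcomes is zero. The support of $\psi$ is $\operatorname{supp}(\psi)=\{\lambda\in\Lambda: p_\psi(\lambda)\ne0\}$. **Lemma.** 1. Let $s$ be a set of $n$-qubit stabilizer states with $|s|>2^{n^2/4+7n/2}$. Then $s$ contains three distinct states $\psi_1,\psi_2,\psi_3$ that have stabilizers forming a Mermin–Peres magic square, and for which there is a single Clifford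 unitary $U$ such that, up to scalars, $U\psi_1$ is a computational basis state and $U\psi_2=|G_1\rangle\otimes|0\rangle^{\otimes(n-k)}$, $U\psi_3=|G_2\rangle\otimes|0\rangle^{\otimes(n-k)}$ for some $k\le n$ and graph states $|G_1\rangle,|G_2\rangle$ on the first $k$ qubits. 2. Consequently, in every ontological theory that simulates Pauli measurements on $n$-qubit stabilizer states, at most $2^{n^2/4+7n/2}$ stabilizer states share a common hidden variable: if $s$ is a set of stabilizer states with $\bigcap_{\psi\in s}\operatorname{supp}(\psi)\neq\emptyset$, then $|s|\le 2^{n^2/4+7n/2}$. -/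

import Mathlib

open scoped Matrix

noncomputable section

namespace MagicSquare

/-- Computational basis labels of `n` qubits. -/
abbrev Bits (n : ℕ) : Type := Fin n → ZMod 2

/-- State vectors of `n` qubits, as amplitude functions on the computational basis. -/
abbrev Vec (n : ℕ) : Type := Bits n → ℂ

/-- Linear operators on `n` qubits, as matrices in the computational basis. -/
abbrev Op (n : ℕ) : Type := Matrix (Bits n) (Bits n) ℂ

/-- Pure states of `n` qubits: nonzero vectors up to a scalar (so global phases are ignored). -/
abbrev PureState (n : ℕ) : Type := Projectivization ℂ (Vec n)

/-- Labels of the single-qubit Pauli matrices. -/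
inductive Pauli : Type
  | I
  | X
  | Y
  | Z

/-- The single-qubit Pauli matrices `I`, `X = [0 1; 1 0]`, `Y = [0 -i; i 0]`, `Z = [1 0; 0 -1]`,
with rows and columns indexed by the bits `0, 1`. -/
def Pauli.mat : Pauli → Matrix (ZMod 2) (ZMod 2) ℂ
  | .I => Matrix.of fun x y => if x = y then 1 else 0
  | .X => Matrix.of fun x y => if x = y then 0 else 1
  | .Y => Matrix.of fun x y => if x = y then 0 else if x = 0 then -Complex.I else Complex.I
  | .Z => Matrix.of fun x y => if x = y then (if x = 0 then 1 else -1) else 0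

/-- The tensor product of single-qubit Pauli matrices. -/
def pauliString {n : ℕ} (p : Fin n → Pauli) : Op n :=
  Matrix.of fun x y => ∏ i, (p i).mat (x i) (y i)

/-- The Pauli observable `± P`, for `P` a tensor product of Pauli matrices. -/
def signedPauli {n : ℕ} (ε : ℤˣ) (p : Fin n → Pauli) : Op n :=
  ((ε : ℤ) : ℂ) • pauliString p

/-- `n`-qubit Pauli observables: tensor products of Pauli matrices with a sign. -/
def IsPauliObservable {n : ℕ} (O : Op n) : Prop :=
  ∃ (ε : ℤˣ) (p : Fin n → Pauli), O = signedPauli ε p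

/-- `O` stabilizes `ψ`: the state is a `+1` eigenvector of `O`. -/
def Stabilizes {n : ℕ} (O : Op n) (ψ : PureState n) : Prop :=
  O *ᵥ ψ.rep = ψ.rep

/-- A stabilizer state is a pure state that is uniquely determined by its stabilizer group: every
vector fixed by all Pauli observables that stabilize `ψ` is a multiple of `ψ`. -/
def IsStabilizerState {n : ℕ} (ψ : PureState n) : Prop :=
  ∀ v : Vec n, (∀ O : Op n, IsPauliObservable O → Stabilizes O ψ → O *ᵥ v = v) → v ∈ ψ.submodule

/-- The type of `n`-qubit stabilizer states. -/
abbrev StabilizerState (n : ℕ) : Type := {ψ : PureState n // IsStabilizerState ψ}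

/-- Clifford unitaries: unitaries that conjugate Pauli observables to Pauli observables. -/
def IsClifford {n : ℕ} (U : Op n) : Prop :=
  U ∈ Matrix.unitaryGroup (Bits n) ℂ ∧
    ∀ p : Fin n → Pauli, IsPauliObservable (U * pauliString p * Uᴴ)

/-- `v` and `w` are nonzero multiples of each other (they represent the same state). -/
def SameRay {n : ℕ} (v w : Vec n) : Prop :=
  ∃ c : ℂ, c ≠ 0 ∧ v = c • w

/-- The computational basis vector `|z⟩`. -/
def basisVec {n : ℕ} (z : Bits n) : Vec n :=
  Pi.single z 1

open Classical in
/-- The (unnormalized) graph state of `G` on `k` qubits: the amplitude of `|x⟩` is `(-1)^e`, with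
`e` the number of edges of `G` both of whose ends carry the bit `1`. -/
def graphVec {k : ℕ} (G : SimpleGraph (Fin k)) : Vec k :=
  fun x => (-1) ^ (Finset.univ.filter fun e : Fin k × Fin k =>
    e.1 < e.2 ∧ G.Adj e.1 e.2 ∧ x e.1 = 1 ∧ x e.2 = 1).card

open Classical in
/-- `v ⊗ |0⟩^{⊗ (n - k)}` for a vector `v` on the first `k` of `n` qubits. -/
def padZero {k n : ℕ} (hk : k ≤ n) (v : Vec k) : Vec n :=
  fun x => if ∀ i : Fin n, k ≤ (i : ℕ) → x i = 0 then v (fun i => x (Fin.castLE hk i)) else 0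

/-- The nine observables
`A   a   Aa`
`B   b   Bb`
`AB  ab  ABab`. -/
def squareTable {n : ℕ} (A a B b : Op n) : Fin 3 → Fin 3 → Op n :=
  ![![A, a, A * a], ![B, b, B * b], ![A * B, a * b, A * B * a * b]]

/-- The Pauli observables `A, a, B, b` generate a Mermin–Peres magic square whose `i`-th row
consists of stabilizers of the state `ψ i`: the table has the stated commutation relations, the
product of each row is `1`, and the products of the columns are `1, 1, -1`. -/
structure IsMagicSquare {n : ℕ} (ψ : Fin 3 → PureState n) (A a B b : Op n) : Prop where
  pauli : ∀ i j, IsPauliObservable (squareTable A a B b i j)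
  stabilizes : ∀ i j, Stabilizes (squareTable A a B b i j) (ψ i)
  comm_A_a : A * a = a * A
  comm_B_b : B * b = b * B
  comm_A_B : A * B = B * A
  comm_a_b : a * b = b * a
  anticomm_A_b : A * b = -(b * A)
  anticomm_a_B : a * B = -(B * a)
  row : ∀ i, squareTable A a B b i 0 * squareTable A a B b i 1 * squareTable A a B b i 2 = 1
  col : ∀ j, squareTable A a B b 0 j * squareTable A a B b 1 j * squareTable A a B b 2 j =
    (![1, 1, -1] : Fin 3 → Op n) j

/-- A Clifford unitary takes `ψ 0` to a computational basis state and, simultaneously, `ψ 1` and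
`ψ 2` to graph states on the first `k` qubits, the remaining qubits being in the state `|0⟩`. -/
def CliffordEquivBasisGraphGraph {n : ℕ} (ψ : Fin 3 → PureState n) : Prop :=
  ∃ U : Op n, IsClifford U ∧
    (∃ z : Bits n, SameRay (U *ᵥ (ψ 0).rep) (basisVec z)) ∧
    ∃ (k : ℕ) (hk : k ≤ n) (G₁ G₂ : SimpleGraph (Fin k)),
      SameRay (U *ᵥ (ψ 1).rep) (padZero hk (graphVec G₁)) ∧
      SameRay (U *ᵥ (ψ 2).rep) (padZero hk (graphVec G₂))

/-- A record of successive Pauli measurements: each entry is a measured Pauli string together with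
its outcome `±1`; the head of the list is the first measurement. -/
abbrev History (n : ℕ) : Type := List ((Fin n → Pauli) × ℤˣ)

/-- The unnormalized state after the measurements and outcomes in a history, starting from `v`: the
outcome `y` of measuring `P` projects with `(1 + y P) / 2`. -/
def collapse {n : ℕ} : History n → Vec n → Vec n
  | [], v => v
  | (p, y) :: h, v => collapse h (((1 / 2 : ℂ) • (1 + signedPauli y p)) *ᵥ v)

/-- The quantum mechanical probability to obtain the outcomes in `h` when the measurements in `h`
are performed successively on the state `ψ`. -/
def quantumProb {n : ℕ} (ψ : PureState n) (h : History n) : ℝ :=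
  (∑ x, ‖collapse h ψ.rep x‖ ^ 2) / ∑ x, ‖ψ.rep x‖ ^ 2

/-- An ontological (hidden variable) theory with finite set `Λ` of hidden variables, for Pauli
measurements on `n`-qubit stabilizer states. -/
structure OntologicalTheory (n : ℕ) (Λ : Type*) [Fintype Λ] where
  /-- The distribution over hidden variables that encodes a stabilizer state. -/
  prep : StabilizerState n → Λ → ℝ
  /-- `response p l y` is the probability of the outcome `y` when `p` is measured in `l`. -/
  response : (Fin n → Pauli) → Λ → ℤˣ → ℝ
  /-- `trans p y l l'` is the probability to move from `l` to `l'` after the measurement of `p`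
  with outcome `y`. -/
  trans : (Fin n → Pauli) → ℤˣ → Λ → Λ → ℝ
  prep_mem : ∀ ψ, prep ψ ∈ stdSimplex ℝ Λ
  response_mem : ∀ p l, response p l ∈ stdSimplex ℝ ℤˣ
  trans_mem : ∀ p y l, trans p y l ∈ stdSimplex ℝ Λ

namespace OntologicalTheory

variable {n : ℕ} {Λ : Type*} [Fintype Λ]

/-- The probability of the outcomes in a history of measurements, starting from the hidden
variable `l`. -/
def probFrom (T : OntologicalTheory n Λ) : History n → Λ → ℝ
  | [], _ => 1
  | (p, y) :: h, l => T.response p l y * ∑ l', T.trans p y l l' * T.probFrom h l'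

/-- The probability the theory assigns to the outcomes in a history of measurements on `ψ`. -/
def prob (T : OntologicalTheory n Λ) (ψ : StabilizerState n) (h : History n) : ℝ :=
  ∑ l, T.prep ψ l * T.probFrom h l

/-- The theory simulates sequential Pauli measurements on stabilizer states: it gives probability
zero to exactly those outcome sequences that have probability zero in quantum mechanics. -/
def Simulates (T : OntologicalTheory n Λ) : Prop :=
  ∀ (ψ : StabilizerState n) (h : History n), T.prob ψ h = 0 ↔ quantumProb ψ.1 h = 0

/-- The hidden variables in which the theory can be when it represents `ψ`. -/
def supp (T : OntologicalTheory n Λ) (ψ : StabilizerState n) : Set Λ :=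
  {l | T.prep ψ l ≠ 0}

end OntologicalTheory

end MagicSquare

end

noncomputable section

namespace MagicSquare

variable {n : ℕ}

/-! ### Bit strings and characters -/

/-! A stabilizer vector is supported on an affine subspace `a + V` of bit strings, and translation
by `v ∈ V` changes it only by a character and a fourth root of unity: its phase is quadratic. With
pivot coordinates `S` for `V`, the subspace is the graph of a matrix `T` from the coordinates in `S`
to the others, and the coset has a unique representative `d` vanishing on `S`. An affine change of
coordinates, which is Clifford, straightens the support to the strings vanishing off `S`. The
`FrameKey` of the vector consists of `S`, `T`, `d` and the exponents `m` of `i` in its values at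
unit strings relative to its value at `0` (`IsStab.exists_key`). For `|S| = k` these are `k(n-k) +
(n-k) + 2k` bits, so there are at most `2^(n²/4) * 6^n` keys (`card_frameKey_le`).

Given more states than keys, move one state to `|0⟩` by a Clifford unitary
(`IsStab.exists_clifford`); two of the states so moved share a key by pigeonhole. In their common
frame, a diagonal Clifford that flattens one of the two turns it into the empty graph state and,
because the values at unit strings agree, turns the other into a graph state; `|0⟩` becomes a basis
state `|z⟩` with `z` zero on the graph's qubits (`exists_common_frame`, `HasChars.eq_graphVec`). The
two states differ, so the second graph has an edge `ij`. The neighbourhood operators `Z^(χ i)`,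
`Z^(χ j)` fix the basis state, `X_i`, `X_j` fix the empty graph state, and their products are the
generators of the other graph state at `i` and `j`. The edge gives exactly the anticommutations of a
magic square (`magicSquare_of_hasKey`).

For hidden variables, measure the last column `Aa`, `Bb`, `ABab` in succession. A variable in all
three supports must answer `+1` each time, one state being responsible for each answer, yet the
product of the column is `-1`, so these three answers never occur together
(`IsMagicSquare.disjoint_supp`). -/

lemma zmod_two_cases (a : ZMod 2) : a = 0 ∨ a = 1 := by
  revert a; decide

lemma add_self_bits (x : Bits n) : x + x = 0 := by
  ext i; exact CharTwo.add_self_eq_zero _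

lemma add_add_cancel_bits (x y : Bits n) : x + y + y = x := by
  rw [add_assoc, add_self_bits, add_zero]

lemma eq_add_comm_bits {x y v : Bits n} : x = y + v ↔ y = x + v := by
  constructor <;> rintro rfl <;> rw [add_add_cancel_bits]

lemma char_sq (χ : AddChar (Bits n) ℂ) (x : Bits n) : χ x * χ x = 1 := by
  rw [← AddChar.map_add_eq_mul, add_self_bits, AddChar.map_zero_eq_one]

lemma char_cases (χ : AddChar (Bits n) ℂ) (x : Bits n) : χ x = 1 ∨ χ x = -1 :=
  mul_self_eq_one_iff.1 (char_sq χ x)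

lemma char_ne_zero (χ : AddChar (Bits n) ℂ) (x : Bits n) : χ x ≠ 0 :=
  left_ne_zero_of_mul_eq_one (char_sq χ x)

/-- The standard basis vector `e_i` of the space of bit strings. -/
def unitBit (i : Fin n) : Bits n := Pi.single i 1

lemma unitBit_same (i : Fin n) : unitBit i i = 1 := by simp [unitBit]

lemma unitBit_of_ne {i j : Fin n} (h : j ≠ i) : unitBit i j = 0 := by simp [unitBit, h]

lemma bits_eq_sum (x : Bits n) : x = ∑ i, Pi.single i (x i) := by
  simp [Finset.univ_sum_single]

lemma char_sum {ι : Type*} (χ : AddChar (Bits n) ℂ) (s : Finset ι) (f : ι → Bits n) :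
    χ (∑ i ∈ s, f i) = ∏ i ∈ s, χ (f i) := by
  classical
  induction s using Finset.induction_on with
  | empty => simp
  | insert a s ha ih => rw [Finset.sum_insert ha, Finset.prod_insert ha, AddChar.map_add_eq_mul, ih]

lemma char_eq_prod (χ : AddChar (Bits n) ℂ) (x : Bits n) :
    χ x = ∏ i, if x i = 0 then 1 else χ (unitBit i) := by
  conv_lhs => rw [bits_eq_sum x]
  rw [char_sum]
  refine Finset.prod_congr rfl fun i _ => ?_
  rcases zmod_two_cases (x i) with h | h <;> simp [h, unitBit]

/-- The character of bit strings with prescribed signs on the unit strings. -/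
def signChar (w : Bits n) : AddChar (Bits n) ℂ where
  toFun x := ∏ i, if w i * x i = 0 then 1 else -1
  map_zero_eq_one' := by simp
  map_add_eq_mul' x y := by
    rw [← Finset.prod_mul_distrib]
    refine Finset.prod_congr rfl fun i _ => ?_
    have h2 : (1 : ZMod 2) + 1 = 0 := by decide
    rcases zmod_two_cases (w i) with hw | hw <;> rcases zmod_two_cases (x i) with hx | hx <;>
      rcases zmod_two_cases (y i) with hy | hy <;> simp [hw, hx, hy, h2]

lemma signChar_unitBit (w : Bits n) (i : Fin n) :
    signChar w (unitBit i) = if w i = 0 then 1 else -1 := by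
  change (∏ j, if w j * unitBit i j = 0 then (1 : ℂ) else -1) = _
  rw [Finset.prod_eq_single i]
  · simp [unitBit_same]
  · intro j _ hj
    simp [unitBit_of_ne hj]
  · simp

/-! ### Tensor products of single-qubit matrices -/

/-- The tensor product of single-qubit matrices. -/
def tensor (A : Fin n → Matrix (ZMod 2) (ZMod 2) ℂ) : Op n :=
  Matrix.of fun x y => ∏ i, A i (x i) (y i)

lemma tensor_apply (A : Fin n → Matrix (ZMod 2) (ZMod 2) ℂ) (x y : Bits n) :
    tensor A x y = ∏ i, A i (x i) (y i) := rfl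

lemma pauliString_eq_tensor (p : Fin n → Pauli) :
    pauliString p = tensor fun i => (p i).mat := rfl

lemma tensor_mul (A B : Fin n → Matrix (ZMod 2) (ZMod 2) ℂ) :
    tensor A * tensor B = tensor fun i => A i * B i := by
  ext x y
  rw [Matrix.mul_apply]
  simp only [tensor_apply, ← Finset.prod_mul_distrib]
  have h : ∀ i, (A i * B i) (x i) (y i) = ∑ a, A i (x i) a * B i a (y i) := fun i =>
    Matrix.mul_apply
  simp only [h]
  rw [Finset.prod_univ_sum, Fintype.piFinset_univ]

lemma tensor_one : tensor (fun _ : Fin n => (1 : Matrix (ZMod 2) (ZMod 2) ℂ)) = 1 := by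
  ext x y
  rw [tensor_apply]
  by_cases h : x = y
  · subst h
    rw [Matrix.one_apply_eq]
    exact Finset.prod_eq_one fun i _ => Matrix.one_apply_eq _
  · obtain ⟨i, hi⟩ := Function.ne_iff.1 h
    rw [Matrix.one_apply_ne h]
    exact Finset.prod_eq_zero (Finset.mem_univ i) (Matrix.one_apply_ne hi)

lemma tensor_conjTranspose (A : Fin n → Matrix (ZMod 2) (ZMod 2) ℂ) :
    (tensor A)ᴴ = tensor fun i => (A i)ᴴ := by
  ext x y
  simp [tensor_apply, Matrix.conjTranspose_apply]

lemma tensor_smul (c : Fin n → ℂ) (A : Fin n → Matrix (ZMod 2) (ZMod 2) ℂ) :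
    (tensor fun i => c i • A i) = (∏ i, c i) • tensor A := by
  ext x y
  simp [tensor_apply, Finset.prod_mul_distrib]

lemma sum_zmod_two {M : Type*} [AddCommMonoid M] (f : ZMod 2 → M) : ∑ a, f a = f 0 + f 1 :=
  Fin.sum_univ_two f

lemma Pauli.mat_mul_self (P : Pauli) : P.mat * P.mat = 1 := by
  ext x y
  rcases zmod_two_cases x with rfl | rfl <;> rcases zmod_two_cases y with rfl | rfl <;>
    cases P <;> simp [Pauli.mat, Matrix.mul_apply, sum_zmod_two]

lemma pauliString_mul_self (p : Fin n → Pauli) : pauliString p * pauliString p = 1 := by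
  simp only [pauliString_eq_tensor, tensor_mul, Pauli.mat_mul_self, tensor_one]

/-! ### Weyl operators -/

/-- The operator `X^v Z^χ` taking `|y⟩` to `χ(y) |y + v⟩`. -/
def weyl (v : Bits n) (χ : AddChar (Bits n) ℂ) : Op n :=
  Matrix.of fun x y => if x = y + v then χ y else 0

lemma weyl_mulVec (v : Bits n) (χ : AddChar (Bits n) ℂ) (φ : Vec n) (x : Bits n) :
    (weyl v χ *ᵥ φ) x = χ (x + v) * φ (x + v) := by
  simp [weyl, Matrix.mulVec, dotProduct, eq_add_comm_bits (x := x)]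

lemma op_ext {A B : Op n} (h : ∀ φ x, (A *ᵥ φ) x = (B *ᵥ φ) x) : A = B :=
  Matrix.mulVec_injective (funext fun φ => funext fun x => h φ x)

lemma weyl_mul (v v' : Bits n) (χ χ' : AddChar (Bits n) ℂ) :
    weyl v χ * weyl v' χ' = χ v' • weyl (v + v') (χ * χ') := by
  refine op_ext fun φ x => ?_
  rw [← Matrix.mulVec_mulVec, Matrix.smul_mulVec, Pi.smul_apply, smul_eq_mul]
  simp only [weyl_mulVec, AddChar.mul_apply, ← add_assoc]
  rw [AddChar.map_add_eq_mul χ (x + v) v']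
  linear_combination (-(χ (x + v) * χ' (x + v + v') * φ (x + v + v'))) * char_sq χ v'

lemma weyl_zero_one : weyl (0 : Bits n) 1 = 1 := by
  refine op_ext fun φ x => ?_
  simp [weyl_mulVec]

lemma weyl_mul_self (v : Bits n) (χ : AddChar (Bits n) ℂ) :
    weyl v χ * weyl v χ = χ v • (1 : Op n) := by
  rw [weyl_mul, add_self_bits]
  congr 1
  rw [← weyl_zero_one]
  congr 1
  ext x
  exact char_sq χ x

/-- The single-qubit operator taking `|0⟩` to `|a⟩` and `|1⟩` to `s |1 + a⟩`. -/
def weylOne (a : ZMod 2) (s : ℂ) : Matrix (ZMod 2) (ZMod 2) ℂ :=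
  Matrix.of fun x y => if x = y + a then (if y = 0 then 1 else s) else 0

lemma weyl_eq_tensor (v : Bits n) (χ : AddChar (Bits n) ℂ) :
    weyl v χ = tensor fun i => weylOne (v i) (χ (unitBit i)) := by
  ext x y
  rw [tensor_apply]
  by_cases h : x = y + v
  · simp only [weyl, weylOne, Matrix.of_apply, h, if_true, Pi.add_apply]
    exact char_eq_prod χ y
  · obtain ⟨i, hi⟩ := Function.ne_iff.1 h
    rw [Finset.prod_eq_zero (Finset.mem_univ i)]
    · simp [weyl, h]
    · exact if_neg hi

lemma weylOne_eq_pauli (a : ZMod 2) {s : ℂ} (hs : s = 1 ∨ s = -1) :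
    ∃ (c : ℂ) (P : Pauli), weylOne a s = c • P.mat := by
  have h2 : (1 : ZMod 2) + 1 = 0 := by decide
  rcases zmod_two_cases a with rfl | rfl <;> rcases hs with rfl | rfl
  · refine ⟨1, .I, ?_⟩
    ext x y
    rcases zmod_two_cases x with rfl | rfl <;> rcases zmod_two_cases y with rfl | rfl <;>
      simp [weylOne, Pauli.mat]
  · refine ⟨1, .Z, ?_⟩
    ext x y
    rcases zmod_two_cases x with rfl | rfl <;> rcases zmod_two_cases y with rfl | rfl <;>
      simp [weylOne, Pauli.mat]
  · refine ⟨1, .X, ?_⟩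
    ext x y
    rcases zmod_two_cases x with rfl | rfl <;> rcases zmod_two_cases y with rfl | rfl <;>
      simp [weylOne, Pauli.mat, h2]
  · refine ⟨-Complex.I, .Y, ?_⟩
    ext x y
    rcases zmod_two_cases x with rfl | rfl <;> rcases zmod_two_cases y with rfl | rfl <;>
      simp [weylOne, Pauli.mat, h2]

lemma Pauli.mat_eq_weylOne (P : Pauli) :
    ∃ (c : ℂ) (a w : ZMod 2), P.mat = c • weylOne a (if w = 0 then 1 else -1) := by
  have h2 : (1 : ZMod 2) + 1 = 0 := by decide
  cases P
  · refine ⟨1, 0, 0, ?_⟩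
    ext x y
    rcases zmod_two_cases x with rfl | rfl <;> rcases zmod_two_cases y with rfl | rfl <;>
      simp [weylOne, Pauli.mat]
  · refine ⟨1, 1, 0, ?_⟩
    ext x y
    rcases zmod_two_cases x with rfl | rfl <;> rcases zmod_two_cases y with rfl | rfl <;>
      simp [weylOne, Pauli.mat, h2]
  · refine ⟨Complex.I, 1, 1, ?_⟩
    ext x y
    rcases zmod_two_cases x with rfl | rfl <;> rcases zmod_two_cases y with rfl | rfl <;>
      simp [weylOne, Pauli.mat, h2]
  · refine ⟨1, 0, 1, ?_⟩
    ext x y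
    rcases zmod_two_cases x with rfl | rfl <;> rcases zmod_two_cases y with rfl | rfl <;>
      simp [weylOne, Pauli.mat]

/-- `O` is a multiple of a Weyl operator. -/
def IsWeyl (O : Op n) : Prop :=
  ∃ (c : ℂ) (v : Bits n) (χ : AddChar (Bits n) ℂ), O = c • weyl v χ

lemma isWeyl_weyl (v : Bits n) (χ : AddChar (Bits n) ℂ) : IsWeyl (weyl v χ) :=
  ⟨1, v, χ, (one_smul _ _).symm⟩

lemma IsWeyl.smul {O : Op n} (h : IsWeyl O) (c : ℂ) : IsWeyl (c • O) := by
  obtain ⟨c', v, χ, rfl⟩ := h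
  exact ⟨c * c', v, χ, by rw [smul_smul]⟩

lemma IsWeyl.mul {O O' : Op n} (h : IsWeyl O) (h' : IsWeyl O') : IsWeyl (O * O') := by
  obtain ⟨c, v, χ, rfl⟩ := h
  obtain ⟨c', v', χ', rfl⟩ := h'
  rw [Matrix.smul_mul, Matrix.mul_smul, weyl_mul]
  exact (((isWeyl_weyl _ _).smul _).smul _).smul _

lemma isWeyl_pauliString (p : Fin n → Pauli) : IsWeyl (pauliString p) := by
  choose c a w h using fun i => (p i).mat_eq_weylOne
  refine ⟨∏ i, c i, a, signChar w, ?_⟩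
  rw [weyl_eq_tensor, ← tensor_smul, pauliString_eq_tensor]
  simp only [h, signChar_unitBit]

lemma weyl_eq_smul_pauliString (v : Bits n) (χ : AddChar (Bits n) ℂ) :
    ∃ (c : ℂ) (p : Fin n → Pauli), weyl v χ = c • pauliString p := by
  choose c p h using fun i => weylOne_eq_pauli (v i) (char_cases χ (unitBit i))
  refine ⟨∏ i, c i, p, ?_⟩
  rw [weyl_eq_tensor, pauliString_eq_tensor, ← tensor_smul]
  simp only [h]

/-- Weyl operators are Pauli strings up to a scalar, and a Pauli string squares to `1`, so squaring
to `1` forces the scalar to be a sign. This replaces case analysis on Pauli labels by characters and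
translations. -/
lemma isPauliObservable_iff {O : Op n} : IsPauliObservable O ↔ O * O = 1 ∧ IsWeyl O := by
  constructor
  · rintro ⟨ε, p, rfl⟩
    refine ⟨?_, (isWeyl_pauliString p).smul _⟩
    rw [signedPauli, Matrix.smul_mul, Matrix.mul_smul, pauliString_mul_self, smul_smul]
    rcases Int.units_eq_one_or ε with rfl | rfl <;> simp
  · rintro ⟨h, c, v, χ, rfl⟩
    obtain ⟨c', p, hp⟩ := weyl_eq_smul_pauliString v χ
    rw [hp, smul_smul] at h ⊢
    rw [Matrix.smul_mul, Matrix.mul_smul, pauliString_mul_self, smul_smul] at h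
    have h1 : (c * c') * (c * c') = 1 := by
      have := congrFun (congrFun h 0) 0
      simpa using this
    rcases mul_self_eq_one_iff.1 h1 with h2 | h2
    · exact ⟨1, p, by simp [signedPauli, h2]⟩
    · exact ⟨-1, p, by simp [signedPauli, h2]⟩

lemma isPauliObservable_weyl {v : Bits n} {χ : AddChar (Bits n) ℂ} (h : χ v = 1) :
    IsPauliObservable (weyl v χ) :=
  isPauliObservable_iff.2 ⟨by rw [weyl_mul_self, h, one_smul], isWeyl_weyl v χ⟩

lemma IsPauliObservable.mul {O O' : Op n} (h : IsPauliObservable O) (h' : IsPauliObservable O')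
    (hc : O * O' = O' * O) : IsPauliObservable (O * O') := by
  rw [isPauliObservable_iff] at *
  refine ⟨?_, h.2.mul h'.2⟩
  calc O * O' * (O * O') = O * (O' * O) * O' := by simp only [mul_assoc]
    _ = (O * O) * (O' * O') := by rw [← hc]; simp only [mul_assoc]
    _ = 1 := by rw [h.1, h'.1, one_mul]

lemma IsPauliObservable.exists_weyl {O : Op n} (h : IsPauliObservable O) :
    ∃ (c : ℂ) (v : Bits n) (χ : AddChar (Bits n) ℂ), c ^ 4 = 1 ∧ O = c • weyl v χ := by
  obtain ⟨h1, c, v, χ, rfl⟩ := isPauliObservable_iff.1 h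
  refine ⟨c, v, χ, ?_, rfl⟩
  rw [Matrix.smul_mul, Matrix.mul_smul, weyl_mul_self, smul_smul, smul_smul] at h1
  have h2 := congrFun (congrFun h1 0) 0
  simp only [Matrix.smul_apply, Matrix.one_apply_eq, smul_eq_mul, mul_one] at h2
  -- `h2` says `c² χ(v) = 1` with `χ(v) = ±1`; squaring gives `c⁴ = 1`.
  linear_combination (c * c * χ v + 1) * h2 - c ^ 4 * char_sq χ v

/-! ### Clifford unitaries -/

lemma unitary_conj_mul {U : Op n} (hU : Uᴴ * U = 1) (O O' : Op n) :
    U * O * Uᴴ * (U * O' * Uᴴ) = U * (O * O') * Uᴴ := by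
  calc U * O * Uᴴ * (U * O' * Uᴴ) = U * O * (Uᴴ * U) * O' * Uᴴ := by simp only [mul_assoc]
    _ = U * (O * O') * Uᴴ := by rw [hU, mul_one]; simp only [mul_assoc]

/-- Conjugation by a unitary preserves the relation `O * O = 1`, so signs take care of themselves
and only the Weyl form has to be checked. -/
lemma isClifford_of_isWeyl {U : Op n} (hU : Uᴴ * U = 1)
    (h : ∀ v χ, IsWeyl (U * weyl v χ * Uᴴ)) : IsClifford U := by
  have hU' : U * Uᴴ = 1 := mul_eq_one_comm.1 hU
  refine ⟨Matrix.mem_unitaryGroup_iff.2 hU', fun p => isPauliObservable_iff.2 ⟨?_, ?_⟩⟩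
  · rw [unitary_conj_mul hU, pauliString_mul_self, mul_one, hU']
  · obtain ⟨c, v, χ, hp⟩ := isWeyl_pauliString p
    rw [hp, Matrix.mul_smul, Matrix.smul_mul]
    exact (h v χ).smul c

lemma IsClifford.mul_conjTranspose {U : Op n} (h : IsClifford U) : U * Uᴴ = 1 :=
  Matrix.mem_unitaryGroup_iff.1 h.1

lemma IsClifford.conjTranspose_mul {U : Op n} (h : IsClifford U) : Uᴴ * U = 1 :=
  mul_eq_one_comm.1 h.mul_conjTranspose

lemma IsClifford.isPauliObservable_conj {U : Op n} (h : IsClifford U) {O : Op n}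
    (hO : IsPauliObservable O) : IsPauliObservable (U * O * Uᴴ) := by
  obtain ⟨ε, p, rfl⟩ := hO
  obtain ⟨ε', p', h'⟩ := h.2 p
  refine ⟨ε * ε', p', ?_⟩
  rw [signedPauli, Matrix.mul_smul, Matrix.smul_mul, h', signedPauli, signedPauli, smul_smul]
  push_cast
  rfl

lemma IsClifford.mul {U U' : Op n} (h : IsClifford U) (h' : IsClifford U') :
    IsClifford (U * U') := by
  refine ⟨mul_mem h.1 h'.1, fun p => ?_⟩
  have : U * U' * pauliString p * (U * U')ᴴ = U * (U' * pauliString p * U'ᴴ) * Uᴴ := by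
    rw [Matrix.conjTranspose_mul]; simp only [mul_assoc]
  rw [this]
  exact h.isPauliObservable_conj (h'.2 p)

instance : Finite Pauli :=
  Finite.of_injective (fun P : Pauli => (match P with
    | .I => 0 | .X => 1 | .Y => 2 | .Z => 3 : Fin 4)) (by
      intro P Q h
      cases P <;> cases Q <;> first | rfl | (exact absurd h (by decide)))

lemma finite_pauliObservables : {O : Op n | IsPauliObservable O}.Finite := by
  have : {O : Op n | IsPauliObservable O} =
      Set.range fun x : ℤˣ × (Fin n → Pauli) => signedPauli x.1 x.2 := by
    ext O
    constructor
    · rintro ⟨ε, p, rfl⟩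
      exact ⟨(ε, p), rfl⟩
    · rintro ⟨x, rfl⟩
      exact ⟨x.1, x.2, rfl⟩
  rw [this]
  exact Set.finite_range _

/-- Conjugation by `U` is an injective self-map of the finite set of Pauli observables, hence onto.
-/
lemma IsClifford.isPauliObservable_conj_symm {U : Op n} (h : IsClifford U) {O : Op n}
    (hO : IsPauliObservable O) : IsPauliObservable (Uᴴ * O * U) := by
  have hcancel : ∀ O : Op n, Uᴴ * (U * O * Uᴴ) * U = O := fun O => by
    calc Uᴴ * (U * O * Uᴴ) * U = (Uᴴ * U) * O * (Uᴴ * U) := by simp only [mul_assoc]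
      _ = O := by rw [h.conjTranspose_mul, one_mul, mul_one]
  have hinj : Function.Injective fun O : Op n => U * O * Uᴴ := fun O O' e => by
    rw [← hcancel O, ← hcancel O']
    exact congrArg (fun O => Uᴴ * O * U) e
  have hsub : (fun O : Op n => U * O * Uᴴ) '' {O | IsPauliObservable O} ⊆
      {O | IsPauliObservable O} := by
    rintro _ ⟨O, hO, rfl⟩
    exact h.isPauliObservable_conj hO
  have heq := Set.eq_of_subset_of_ncard_le hsub (Set.ncard_image_of_injective _ hinj).ge
    finite_pauliObservables
  obtain ⟨O', hO', rfl⟩ : O ∈ (fun O : Op n => U * O * Uᴴ) '' {O | IsPauliObservable O} :=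
    by rw [heq]; exact hO
  change IsPauliObservable (Uᴴ * (U * O' * Uᴴ) * U)
  rw [hcancel]
  exact hO'

lemma isClifford_weyl (v : Bits n) : IsClifford (weyl v 1) := by
  have hT : (weyl v (1 : AddChar (Bits n) ℂ))ᴴ = weyl v 1 := by
    ext x y
    simp only [weyl, Matrix.conjTranspose_apply, Matrix.of_apply, AddChar.one_apply,
      eq_add_comm_bits (x := x)]
    split_ifs <;> simp
  refine isClifford_of_isWeyl ?_ fun w χ => ?_
  · rw [hT, weyl_mul_self]
    simp
  · rw [hT]
    exact ((isWeyl_weyl _ _).mul (isWeyl_weyl _ _)).mul (isWeyl_weyl _ _)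

/-- The operator taking `|y⟩` to `|M y⟩`. -/
def permOp (M : Bits n ≃+ Bits n) : Op n :=
  Matrix.of fun x y => if M.symm x = y then 1 else 0

lemma permOp_mulVec (M : Bits n ≃+ Bits n) (φ : Vec n) (x : Bits n) :
    (permOp M *ᵥ φ) x = φ (M.symm x) := by
  simp [permOp, Matrix.mulVec, dotProduct]

lemma permOp_conjTranspose (M : Bits n ≃+ Bits n) : (permOp M)ᴴ = permOp M.symm := by
  ext x y
  simp only [permOp, Matrix.conjTranspose_apply, Matrix.of_apply]
  by_cases h : M.symm y = x
  · rw [if_pos h, if_pos]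
    · simp
    · rw [← h]; simp
  · rw [if_neg h, if_neg]
    · simp
    · rintro rfl
      exact h (by simp)

lemma isClifford_permOp (M : Bits n ≃+ Bits n) : IsClifford (permOp M) := by
  refine isClifford_of_isWeyl ?_ fun v χ => ⟨1, M v, χ.compAddMonoidHom M.symm, ?_⟩
  · rw [permOp_conjTranspose]
    refine op_ext fun φ x => ?_
    simp [← Matrix.mulVec_mulVec, permOp_mulVec]
  · rw [permOp_conjTranspose]
    refine op_ext fun φ x => ?_
    rw [one_smul]
    simp only [← Matrix.mulVec_mulVec, permOp_mulVec, weyl_mulVec]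
    simp

/-- Conjugating `X^v Z^χ` by the phases multiplies it by `θ(x) * star (θ(x + v))`, which `h2` makes
a constant times a character. -/
lemma isClifford_diagonal {θ : Bits n → ℂ} (h1 : ∀ x, ‖θ x‖ = 1)
    (h2 : ∀ v, ∃ (c : ℂ) (χ : AddChar (Bits n) ℂ), ∀ x, θ (x + v) = c * χ x * θ x) :
    IsClifford (Matrix.diagonal θ) := by
  have hθ : ∀ x, star (θ x) * θ x = 1 := fun x => by
    have := Complex.conj_mul' (θ x)
    rw [h1] at this
    simpa using this
  refine isClifford_of_isWeyl ?_ fun v χ => ?_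
  · rw [Matrix.diagonal_conjTranspose, Matrix.diagonal_mul_diagonal]
    simp only [Pi.star_apply, hθ]
    exact Matrix.diagonal_one
  · obtain ⟨c, χ', h'⟩ := h2 v
    refine ⟨star c * χ' v, v, χ * χ', op_ext fun φ x => ?_⟩
    rw [Matrix.smul_mulVec, Pi.smul_apply, weyl_mulVec, ← Matrix.mulVec_mulVec,
      ← Matrix.mulVec_mulVec, Matrix.mulVec_diagonal, weyl_mulVec,
      Matrix.diagonal_conjTranspose, Matrix.mulVec_diagonal, Pi.star_apply, h' x,
      smul_eq_mul, AddChar.mul_apply, AddChar.map_add_eq_mul χ']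
    have hs : star (χ' x) = χ' x := by
      rcases char_cases χ' x with h | h <;> rw [h] <;> simp
    simp only [star_mul', hs]
    linear_combination (star c * χ' x * χ (x + v) * φ (x + v)) * (hθ x - char_sq χ' v)

/-- The Hadamard matrix. -/
def hadamard : Matrix (ZMod 2) (ZMod 2) ℂ :=
  Matrix.of fun x y => ((Real.sqrt 2)⁻¹ : ℝ) * (if x = 0 then 1 else if y = 0 then 1 else -1)

lemma inv_sqrt_two_mul_self :
    (((Real.sqrt 2)⁻¹ : ℝ) : ℂ) * (((Real.sqrt 2)⁻¹ : ℝ) : ℂ) = 1 / 2 := by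
  rw [← Complex.ofReal_mul, ← mul_inv, Real.mul_self_sqrt (by norm_num)]
  norm_num

lemma hadamard_conjTranspose : hadamardᴴ = hadamard := by
  ext x y
  rcases zmod_two_cases x with rfl | rfl <;> rcases zmod_two_cases y with rfl | rfl <;>
    simp [hadamard, Matrix.conjTranspose_apply]

lemma hadamard_mul_self : hadamard * hadamard = 1 := by
  have h := inv_sqrt_two_mul_self
  ext x y
  rcases zmod_two_cases x with rfl | rfl <;> rcases zmod_two_cases y with rfl | rfl <;>
    simp only [hadamard, Matrix.mul_apply, sum_zmod_two, Matrix.of_apply, if_true, one_ne_zero,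
      if_false, Matrix.one_apply, zero_ne_one] <;> first | linear_combination 2 * h | ring

lemma hadamard_conj_pauli (P : Pauli) :
    ∃ (c : ℂ) (Q : Pauli), hadamard * P.mat * hadamard = c • Q.mat := by
  have h := inv_sqrt_two_mul_self
  cases P
  · refine ⟨1, .I, ?_⟩
    ext x y
    rcases zmod_two_cases x with rfl | rfl <;> rcases zmod_two_cases y with rfl | rfl <;>
      simp [Matrix.mul_apply, sum_zmod_two, hadamard, Pauli.mat] <;>
      simp at h <;> first | done | linear_combination 2 * h
  · refine ⟨1, .Z, ?_⟩
    ext x y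
    rcases zmod_two_cases x with rfl | rfl <;> rcases zmod_two_cases y with rfl | rfl <;>
      simp [Matrix.mul_apply, sum_zmod_two, hadamard, Pauli.mat] <;>
      simp at h <;> first | done | linear_combination 2 * h | linear_combination -2 * h
  · refine ⟨-1, .Y, ?_⟩
    ext x y
    rcases zmod_two_cases x with rfl | rfl <;> rcases zmod_two_cases y with rfl | rfl <;>
      simp [Matrix.mul_apply, sum_zmod_two, hadamard, Pauli.mat] <;>
      simp at h <;>
      first | done | linear_combination 2 * Complex.I * h | linear_combination -2 * Complex.I * h
  · refine ⟨1, .X, ?_⟩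
    ext x y
    rcases zmod_two_cases x with rfl | rfl <;> rcases zmod_two_cases y with rfl | rfl <;>
      simp [Matrix.mul_apply, sum_zmod_two, hadamard, Pauli.mat] <;>
      simp at h <;> first | done | linear_combination 2 * h

/-- The Hadamard gate on the qubits in `S`. -/
def hadamardOn (S : Finset (Fin n)) : Op n :=
  tensor fun i => if i ∈ S then hadamard else 1

lemma hadamardOn_mul_self (S : Finset (Fin n)) : hadamardOn S * hadamardOn S = 1 := by
  rw [hadamardOn, tensor_mul, ← tensor_one]
  congr 1
  ext1 i
  split_ifs <;> simp [hadamard_mul_self]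

lemma hadamardOn_conjTranspose (S : Finset (Fin n)) : (hadamardOn S)ᴴ = hadamardOn S := by
  rw [hadamardOn, tensor_conjTranspose]
  congr 1
  ext1 i
  split_ifs <;> simp [hadamard_conjTranspose]

lemma isClifford_hadamardOn (S : Finset (Fin n)) : IsClifford (hadamardOn S) := by
  refine isClifford_of_isWeyl ?_ fun v χ => ?_
  · rw [hadamardOn_conjTranspose, hadamardOn_mul_self]
  · obtain ⟨c, p, hp⟩ := weyl_eq_smul_pauliString v χ
    rw [hp, Matrix.mul_smul, Matrix.smul_mul]
    refine IsWeyl.smul ?_ c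
    have h : ∀ i, ∃ (c : ℂ) (Q : Pauli), (if i ∈ S then hadamard else 1) * (p i).mat *
        (if i ∈ S then hadamard else 1) = c • Q.mat := fun i => by
      split_ifs
      · exact hadamard_conj_pauli _
      · exact ⟨1, p i, by simp⟩
    choose d q hq using h
    rw [hadamardOn_conjTranspose, hadamardOn, pauliString_eq_tensor, tensor_mul, tensor_mul]
    simp only [hq]
    rw [tensor_smul, ← pauliString_eq_tensor]
    exact (isWeyl_pauliString q).smul _

/-! ### Stabilizer vectors -/

/-- `φ` is nonzero and, up to scalars, the only vector fixed by the Pauli observables fixing it. -/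
def IsStab (φ : Vec n) : Prop :=
  φ ≠ 0 ∧ ∀ u : Vec n, (∀ O : Op n, IsPauliObservable O → O *ᵥ φ = φ → O *ᵥ u = u) →
    ∃ c : ℂ, u = c • φ

lemma IsStabilizerState.isStab_rep {ψ : PureState n} (h : IsStabilizerState ψ) :
    IsStab ψ.rep := by
  refine ⟨ψ.rep_nonzero, fun u hu => ?_⟩
  have h1 := h u hu
  rw [Projectivization.submodule_eq, Submodule.mem_span_singleton] at h1
  obtain ⟨c, hc⟩ := h1
  exact ⟨c, hc.symm⟩

lemma IsClifford.mulVec_cancel {U : Op n} (h : IsClifford U) (φ : Vec n) :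
    Uᴴ *ᵥ (U *ᵥ φ) = φ := by
  rw [Matrix.mulVec_mulVec, h.conjTranspose_mul, Matrix.one_mulVec]

lemma IsClifford.mulVec_cancel' {U : Op n} (h : IsClifford U) (φ : Vec n) :
    U *ᵥ (Uᴴ *ᵥ φ) = φ := by
  rw [Matrix.mulVec_mulVec, h.mul_conjTranspose, Matrix.one_mulVec]

lemma IsClifford.mulVec_injective {U : Op n} (h : IsClifford U) {φ φ' : Vec n}
    (e : U *ᵥ φ = U *ᵥ φ') : φ = φ' := by
  rw [← h.mulVec_cancel φ, e, h.mulVec_cancel]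

lemma IsStab.mulVec {U : Op n} (hU : IsClifford U) {φ : Vec n} (h : IsStab φ) :
    IsStab (U *ᵥ φ) := by
  refine ⟨fun h0 => h.1 (hU.mulVec_injective (by rw [h0, Matrix.mulVec_zero])), fun u hu => ?_⟩
  obtain ⟨c, hc⟩ := h.2 (Uᴴ *ᵥ u) fun O hO hφ => by
    have h1 := hu _ (hU.isPauliObservable_conj hO)
      (by simp only [← Matrix.mulVec_mulVec, hU.mulVec_cancel, hφ])
    conv_rhs => rw [← h1]
    simp only [← Matrix.mulVec_mulVec, hU.mulVec_cancel]
  exact ⟨c, by rw [← hU.mulVec_cancel' u, hc, Matrix.mulVec_smul]⟩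

/-- The translations under which `φ` only changes by a character and a fourth root of unity. -/
def shiftSpace (φ : Vec n) : Submodule (ZMod 2) (Bits n) where
  carrier := {v | ∃ (c : ℂ) (χ : AddChar (Bits n) ℂ), c ^ 4 = 1 ∧
    ∀ x, φ (x + v) = c * χ x * φ x}
  zero_mem' := ⟨1, 1, one_pow 4, fun x => by simp⟩
  add_mem' := by
    rintro v v' ⟨c, χ, hc, h⟩ ⟨c', χ', hc', h'⟩
    refine ⟨c * c' * χ' v, χ * χ', ?_, fun x => ?_⟩
    · have := char_sq χ' v
      rw [mul_pow, mul_pow, hc, hc']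
      linear_combination (χ' v * χ' v + 1) * this
    · rw [← add_assoc, h', h, AddChar.map_add_eq_mul, AddChar.mul_apply]
      ring
  smul_mem' := by
    rintro a v h
    rcases zmod_two_cases a with rfl | rfl
    · rw [zero_smul]
      exact ⟨1, 1, one_pow 4, fun x => by simp⟩
    · rwa [one_smul]

lemma ne_zero_of_pow_four {c : ℂ} (h : c ^ 4 = 1) : c ≠ 0 := by
  rintro rfl
  norm_num at h

lemma mem_shiftSpace_of_fixed {φ : Vec n} {c : ℂ} {v : Bits n} {χ : AddChar (Bits n) ℂ}
    (hc : c ^ 4 = 1) (h : (c • weyl v χ) *ᵥ φ = φ) : v ∈ shiftSpace φ := by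
  have hc0 := ne_zero_of_pow_four hc
  refine ⟨c⁻¹ * χ v, χ, ?_, fun x => ?_⟩
  · rw [mul_pow, inv_pow, hc]
    linear_combination (χ v * χ v + 1) * char_sq χ v
  · have := congrFun h x
    rw [Matrix.smul_mulVec, Pi.smul_apply, weyl_mulVec, smul_eq_mul] at this
    rw [← this, mul_assoc, mul_assoc, mul_left_comm (χ x), mul_left_comm (χ v), ← mul_assoc c⁻¹,
      inv_mul_cancel₀ hc0, AddChar.map_add_eq_mul]
    linear_combination (-(φ (x + v))) * (χ x * χ x * char_sq χ v + char_sq χ x)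

/-- The support of a stabilizer vector is a coset of its shift space. -/
lemma IsStab.ne_zero_iff {φ : Vec n} (h : IsStab φ) {a : Bits n} (ha : φ a ≠ 0) (x : Bits n) :
    φ x ≠ 0 ↔ x + a ∈ shiftSpace φ := by
  classical
  constructor
  · intro hx
    by_contra hxa
    -- Cut `φ` down to the coset of `a`. Stabilizers of `φ` translate by elements of `shiftSpace φ`,
    -- so they also fix the truncation, which is therefore a multiple of `φ`. A nonzero value off
    -- the coset would make that multiple `0`, contrary to the value at `a`.
    obtain ⟨k, hk⟩ := h.2 (fun x => if x + a ∈ shiftSpace φ then φ x else 0) fun O hO hφ => by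
      obtain ⟨c, v, χ, hc, rfl⟩ := hO.exists_weyl
      have hv := mem_shiftSpace_of_fixed hc hφ
      ext x
      have h1 := congrFun hφ x
      rw [Matrix.smul_mulVec, Pi.smul_apply, weyl_mulVec, smul_eq_mul] at h1 ⊢
      have hiff : x + v + a ∈ shiftSpace φ ↔ x + a ∈ shiftSpace φ := by
        rw [add_right_comm]
        exact Submodule.add_mem_iff_left _ hv
      by_cases hxa : x + a ∈ shiftSpace φ
      · rw [if_pos hxa, if_pos (hiff.2 hxa), h1]
      · rw [if_neg hxa, if_neg (mt hiff.1 hxa), mul_zero, mul_zero]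
    have h1 := congrFun hk a
    have h2 := congrFun hk x
    simp only [add_self_bits, Submodule.zero_mem, if_true, Pi.smul_apply, smul_eq_mul, hxa,
      if_false] at h1 h2
    rcases mul_eq_zero.1 h2.symm with h3 | h3
    · rw [h3, zero_mul] at h1
      exact ha h1
    · exact hx h3
  · rintro ⟨c, χ, hc, hx⟩
    have := hx a
    rw [add_comm x a, ← add_assoc, add_self_bits, zero_add] at this
    rw [this]
    exact mul_ne_zero (mul_ne_zero (ne_zero_of_pow_four hc) (char_ne_zero χ a)) ha

/-- Every subspace of bit strings has a set of pivot coordinates. -/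
lemma exists_pivots (V : Submodule (ZMod 2) (Bits n)) :
    ∃ S : Finset (Fin n), (∀ v ∈ V, (∀ i ∈ S, v i = 0) → v = 0) ∧
      ∀ i ∈ S, ∃ b ∈ V, b i = 1 ∧ ∀ j ∈ S, j ≠ i → b j = 0 := by
  classical
  -- Take a smallest set of coordinates that determines the elements of `V`. As no `i ∈ S` can be
  -- dropped, some element of `V` is nonzero at `i` alone among the coordinates in `S`.
  obtain ⟨S, hS, hmin⟩ := Finset.exists_min_image
    (Finset.univ.filter fun S : Finset (Fin n) => ∀ v ∈ V, (∀ i ∈ S, v i = 0) → v = 0)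
    Finset.card ⟨Finset.univ, by
      rw [Finset.mem_filter]
      exact ⟨Finset.mem_univ _, fun v _ h => funext fun i => h i (Finset.mem_univ i)⟩⟩
  rw [Finset.mem_filter] at hS
  refine ⟨S, hS.2, fun i hi => ?_⟩
  by_contra! hcon
  have : S.erase i ∈ Finset.univ.filter fun S : Finset (Fin n) =>
      ∀ v ∈ V, (∀ i ∈ S, v i = 0) → v = 0 := by
    rw [Finset.mem_filter]
    refine ⟨Finset.mem_univ _, fun v hv h => hS.2 v hv fun j hj => ?_⟩
    by_cases hji : j = i
    · subst hji
      rcases zmod_two_cases (v j) with h0 | h1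
      · exact h0
      · obtain ⟨l, hl, hlj, hne⟩ := hcon v hv h1
        exact absurd (h l (Finset.mem_erase.2 ⟨hlj, hl⟩)) hne
    · exact h j (Finset.mem_erase.2 ⟨hji, hj⟩)
  have h1 := hmin _ this
  rw [Finset.card_erase_of_mem hi] at h1
  have h2 := Finset.card_pos.2 ⟨i, hi⟩
  omega

/-! ### Frames -/

/-- The vectors of full support and locally quadratic phase on the bit strings vanishing
off `S`. -/
structure IsQuadOn (S : Finset (Fin n)) (φ : Vec n) : Prop where
  ne_zero_iff : ∀ x, φ x ≠ 0 ↔ ∀ i ∉ S, x i = 0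
  shift : ∀ p : Bits n, (∀ i ∉ S, p i = 0) → ∃ (c : ℂ) (χ : AddChar (Bits n) ℂ), c ^ 4 = 1 ∧
    ∀ x, φ (x + p) = c * χ x * φ x

/-- The nilpotent map taking the coordinates in `S` to those outside by the matrix `T`. -/
def nilMap (S : Finset (Fin n)) (T : {j // j ∉ S} × {i // i ∈ S} → ZMod 2) : Bits n →+ Bits n :=
  AddMonoidHom.mk' (fun x j => if h : j ∈ S then 0 else ∑ i : {i // i ∈ S}, T (⟨j, h⟩, i) * x i)
    fun x y => by
      ext j
      by_cases h : j ∈ S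
      · simp [h]
      · simp [h, mul_add, Finset.sum_add_distrib]

section Frame

variable (S : Finset (Fin n)) (T : {j // j ∉ S} × {i // i ∈ S} → ZMod 2)

lemma nilMap_of_mem (x : Bits n) {j : Fin n} (h : j ∈ S) : nilMap S T x j = 0 := by
  simp [nilMap, h]

lemma nilMap_of_not_mem (x : Bits n) {j : Fin n} (h : j ∉ S) :
    nilMap S T x j = ∑ i : {i // i ∈ S}, T (⟨j, h⟩, i) * x i := by
  simp [nilMap, h]

lemma nilMap_eq_zero {x : Bits n} (h : ∀ i ∈ S, x i = 0) : nilMap S T x = 0 := by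
  ext j
  by_cases hj : j ∈ S
  · rw [nilMap_of_mem S T x hj, Pi.zero_apply]
  · rw [nilMap_of_not_mem S T x hj]
    exact Finset.sum_eq_zero fun i _ => by rw [h i i.2, mul_zero]

/-- The map reads only the coordinates in `S` and writes only the others; over `ZMod 2` this makes
`x ↦ x + N x` its own inverse. -/
lemma nilMap_nilMap (x : Bits n) : nilMap S T (nilMap S T x) = 0 :=
  nilMap_eq_zero S T fun _ hi => nilMap_of_mem S T x hi

lemma shear_shear (x : Bits n) : x + nilMap S T x + nilMap S T (x + nilMap S T x) = x := by
  rw [map_add, nilMap_nilMap, add_zero, add_add_cancel_bits]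

/-- The involution `x ↦ x + N x`, with `N` the nilpotent map of `T`. -/
def shear : Bits n ≃+ Bits n where
  toFun x := x + nilMap S T x
  invFun x := x + nilMap S T x
  left_inv := shear_shear S T
  right_inv := shear_shear S T
  map_add' x y := by rw [map_add]; abel

lemma shear_apply (x : Bits n) : shear S T x = x + nilMap S T x := rfl

lemma shear_symm_apply (x : Bits n) : (shear S T).symm x = x + nilMap S T x := rfl

variable (d : {j // j ∉ S} → ZMod 2)

/-- The bit string that is `d` outside of `S` and zero on `S`. -/
def padOff : Bits n := fun j => if h : j ∈ S then 0 else d ⟨j, h⟩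

lemma padOff_of_mem {j : Fin n} (h : j ∈ S) : padOff S d j = 0 := by
  simp [padOff, h]

lemma padOff_of_not_mem {j : Fin n} (h : j ∉ S) : padOff S d j = d ⟨j, h⟩ := by
  simp [padOff, h]

/-- The Clifford unitary of the affine change of coordinates given by `T` and `d`. -/
def frameOp : Op n := permOp (shear S T) * weyl (padOff S d) 1

lemma isClifford_frameOp : IsClifford (frameOp S T d) :=
  (isClifford_permOp _).mul (isClifford_weyl _)

lemma frameOp_mulVec (φ : Vec n) (x : Bits n) :
    (frameOp S T d *ᵥ φ) x = φ (x + nilMap S T x + padOff S d) := by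
  rw [frameOp, ← Matrix.mulVec_mulVec, permOp_mulVec, weyl_mulVec, AddChar.one_apply, one_mul,
    shear_symm_apply]

end Frame

/-- The discrete data that determine the coordinate change and the values on unit strings of a
stabilizer vector. -/
abbrev FrameKey (n : ℕ) : Type :=
  Σ S : Finset (Fin n), ({j // j ∉ S} × {i // i ∈ S} → ZMod 2) × ({j // j ∉ S} → ZMod 2) ×
    ({i // i ∈ S} → Fin 4)

/-- The vector `φ` takes the standard form in the coordinates given by a key. -/
def HasKey (φ : Vec n) (κ : FrameKey n) : Prop :=
  IsQuadOn κ.1 (frameOp κ.1 κ.2.1 κ.2.2.1 *ᵥ φ) ∧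
    ∀ i : {i // i ∈ κ.1}, (frameOp κ.1 κ.2.1 κ.2.2.1 *ᵥ φ) (unitBit i) =
      Complex.I ^ (κ.2.2.2 i : ℕ) * (frameOp κ.1 κ.2.1 κ.2.2.1 *ᵥ φ) 0

lemma exists_I_pow {c : ℂ} (h : c ^ 4 = 1) : ∃ m : Fin 4, c = Complex.I ^ (m : ℕ) := by
  have h1 : (c - 1) * (c + 1) * ((c - Complex.I) * (c + Complex.I)) = 0 := by
    linear_combination h - (c ^ 2 - 1) * Complex.I_sq
  rcases mul_eq_zero.1 h1 with h1 | h1 <;> rcases mul_eq_zero.1 h1 with h2 | h2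
  · exact ⟨0, by simpa [sub_eq_zero] using h2⟩
  · exact ⟨2, by simpa [Complex.I_sq] using eq_neg_of_add_eq_zero_left h2⟩
  · exact ⟨1, by simpa [sub_eq_zero] using h2⟩
  · exact ⟨3, by simpa [Complex.I_pow_three] using eq_neg_of_add_eq_zero_left h2⟩

/-- In pivot coordinates `shiftSpace φ` is the graph of `T`, whose columns are the pivot vectors `b
i`; the shear carries this graph to the coordinate subspace of `S`, and the quadratic phase survives
the linear change. -/
lemma IsStab.exists_key {φ : Vec n} (h : IsStab φ) : ∃ κ : FrameKey n, HasKey φ κ := by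
  classical
  obtain ⟨a, ha⟩ := Function.ne_iff.1 h.1
  rw [Pi.zero_apply] at ha
  obtain ⟨S, hinj, hb⟩ := exists_pivots (shiftSpace φ)
  choose! b hbV hb1 hb0 using hb
  have hsum : ∀ (x : Bits n), ∑ i : {i // i ∈ S}, x i • b i ∈ shiftSpace φ := fun x =>
    Submodule.sum_mem _ fun i _ => Submodule.smul_mem _ _ (hbV i i.2)
  have hsumS : ∀ (x : Bits n), ∀ j ∈ S, (∑ i : {i // i ∈ S}, x i • b i) j = x j := fun x j hj => by
    rw [Finset.sum_apply, Finset.sum_eq_single ⟨j, hj⟩]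
    · simp [hb1 j hj]
    · intro i _ hij
      simp [hb0 i i.2 j hj fun e => hij (Subtype.ext e.symm)]
    · simp
  let T : {j // j ∉ S} × {i // i ∈ S} → ZMod 2 := fun t => b t.2 t.1
  have hN : ∀ (x : Bits n), ∀ j ∉ S, nilMap S T x j = (∑ i : {i // i ∈ S}, x i • b i) j :=
    fun x j hj => by
      rw [nilMap_of_not_mem S T x hj, Finset.sum_apply]
      exact Finset.sum_congr rfl fun i _ => by simp [T, mul_comm]
  have hmem : ∀ v : Bits n, v ∈ shiftSpace φ ↔ ∀ j ∉ S, v j = nilMap S T v j := fun v => by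
    have h1 : (∀ j ∉ S, v j = nilMap S T v j) ↔ v = ∑ i : {i // i ∈ S}, v i • b i := by
      constructor
      · intro hv
        ext j
        by_cases hj : j ∈ S
        · rw [hsumS v j hj]
        · rw [hv j hj, hN v j hj]
      · intro hv j hj
        rw [hN v j hj, ← hv]
    rw [h1]
    constructor
    · intro hv
      have h2 := hinj _ (Submodule.add_mem _ hv (hsum v)) fun i hi => by
        rw [Pi.add_apply, hsumS v i hi, CharTwo.add_self_eq_zero]
      have h3 := congrArg (· + ∑ i : {i // i ∈ S}, v i • b i) h2
      simpa only [add_add_cancel_bits, zero_add] using h3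
    · intro hv
      rw [hv]
      exact hsum v
  -- Clear the coordinates of `a` in `S` without leaving its coset, so that only the entries off `S`
  -- need recording.
  let a' : Bits n := a + ∑ i : {i // i ∈ S}, a i • b i
  have ha'S : ∀ j ∈ S, a' j = 0 := fun j hj => by
    change (a + ∑ i : {i // i ∈ S}, a i • b i) j = 0
    rw [Pi.add_apply, hsumS a j hj, CharTwo.add_self_eq_zero]
  have ha' : φ a' ≠ 0 := by
    rw [h.ne_zero_iff ha, add_right_comm, add_self_bits, zero_add]
    exact hsum a
  let d : {j // j ∉ S} → ZMod 2 := fun j => a' j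
  have hd : padOff S d = a' := by
    ext j
    by_cases hj : j ∈ S
    · rw [padOff_of_mem S d hj, ha'S j hj]
    · rw [padOff_of_not_mem S d hj]
  have hQ : IsQuadOn S (frameOp S T d *ᵥ φ) := by
    constructor
    · intro x
      rw [frameOp_mulVec, hd, h.ne_zero_iff ha', add_add_cancel_bits, hmem]
      refine forall₂_congr fun j hj => ?_
      rw [map_add, nilMap_nilMap, add_zero, Pi.add_apply, add_eq_right]
    · intro p hp
      have : p + nilMap S T p ∈ shiftSpace φ := by
        rw [hmem]
        intro j hj
        rw [map_add, nilMap_nilMap, add_zero, Pi.add_apply, hp j hj, zero_add]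
      obtain ⟨c, χ, hc, hχ⟩ := this
      -- The argument of `χ` is the sheared `x` plus the offset `a'`; the offset contributes the
      -- constant sign `χ a'`.
      refine ⟨c * χ a', χ.compAddMonoidHom (shear S T).toAddMonoidHom, ?_, fun x => ?_⟩
      · rw [mul_pow, hc]
        linear_combination (χ a' * χ a' + 1) * char_sq χ a'
      · rw [frameOp_mulVec, frameOp_mulVec, hd, map_add]
        have e : x + p + (nilMap S T x + nilMap S T p) + a' =
            x + nilMap S T x + a' + (p + nilMap S T p) := by abel
        rw [e, hχ, AddChar.map_add_eq_mul]
        simp only [AddChar.compAddMonoidHom_apply]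
        change _ = c * χ a' * χ (x + nilMap S T x) * _
        ring
  have hval : ∀ i : {i // i ∈ S}, ∃ m : Fin 4, (frameOp S T d *ᵥ φ) (unitBit i) =
      Complex.I ^ (m : ℕ) * (frameOp S T d *ᵥ φ) 0 := fun i => by
    obtain ⟨c, χ, hc, hχ⟩ := hQ.shift (unitBit i) fun j hj =>
      unitBit_of_ne fun e => hj (e ▸ i.2)
    obtain ⟨m, rfl⟩ := exists_I_pow hc
    refine ⟨m, ?_⟩
    have := hχ 0
    rwa [zero_add, AddChar.map_zero_eq_one, mul_one] at this
  choose m hm using hval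
  exact ⟨⟨S, T, d, m⟩, hQ, hm⟩

/-! ### Reduction to basis and graph states -/

lemma weyl_mulVec_basisVec (v z : Bits n) :
    weyl v 1 *ᵥ basisVec z = basisVec (z + v) := by
  ext x
  rw [weyl_mulVec, AddChar.one_apply, one_mul, basisVec, basisVec, Pi.single_apply,
    Pi.single_apply]
  exact if_congr (by rw [eq_comm, eq_add_comm_bits, eq_comm]) rfl rfl

lemma permOp_mulVec_basisVec (M : Bits n ≃+ Bits n) (z : Bits n) :
    permOp M *ᵥ basisVec z = basisVec (M z) := by
  ext x
  rw [permOp_mulVec, basisVec, basisVec, Pi.single_apply, Pi.single_apply]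
  exact if_congr (M.symm_apply_eq) rfl rfl

/-- The offset vanishes on `S`, so the shear fixes it. Hence the image of `|0⟩` is still zero on `S`
and is fixed by every `Z`-type operator supported there. -/
lemma frameOp_mulVec_basisVec_zero (S : Finset (Fin n))
    (T : {j // j ∉ S} × {i // i ∈ S} → ZMod 2) (d : {j // j ∉ S} → ZMod 2) :
    frameOp S T d *ᵥ basisVec 0 = basisVec (padOff S d) := by
  rw [frameOp, ← Matrix.mulVec_mulVec, weyl_mulVec_basisVec, zero_add, permOp_mulVec_basisVec,
    shear_apply, nilMap_eq_zero S T fun i hi => padOff_of_mem S d hi, add_zero]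

lemma diagonal_mulVec_basisVec (θ : Bits n → ℂ) (z : Bits n) :
    Matrix.diagonal θ *ᵥ basisVec z = θ z • basisVec z := by
  ext x
  rw [Matrix.mulVec_diagonal, Pi.smul_apply, smul_eq_mul, basisVec, Pi.single_apply]
  split_ifs with h
  · rw [h]
  · simp

open Classical in
/-- The indicator vector of the bit strings vanishing off `S`. -/
def indVec (S : Finset (Fin n)) : Vec n := fun x => if ∀ i ∉ S, x i = 0 then 1 else 0

lemma hadamardOn_mulVec_basisVec_zero (S : Finset (Fin n)) :
    ∃ c : ℂ, c ≠ 0 ∧ hadamardOn S *ᵥ basisVec 0 = c • indVec S := by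
  classical
  have h0 : (((Real.sqrt 2)⁻¹ : ℝ) : ℂ) ≠ 0 :=
    left_ne_zero_of_mul (a := (((Real.sqrt 2)⁻¹ : ℝ) : ℂ)) (by
      rw [inv_sqrt_two_mul_self]; norm_num)
  refine ⟨∏ i : Fin n, if i ∈ S then (((Real.sqrt 2)⁻¹ : ℝ) : ℂ) else 1,
    Finset.prod_ne_zero_iff.2 fun i _ => by split_ifs <;> simp_all, ?_⟩
  ext x
  rw [basisVec, Matrix.mulVec_single_one, Pi.smul_apply, indVec, smul_eq_mul]
  change tensor _ x 0 = _
  rw [tensor_apply]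
  split_ifs with h
  · rw [mul_one]
    refine Finset.prod_congr rfl fun i _ => ?_
    split_ifs with hi
    · rcases zmod_two_cases (x i) with hx | hx <;> simp [hadamard, hx]
    · change (1 : Matrix (ZMod 2) (ZMod 2) ℂ) (x i) 0 = 1
      rw [h i hi]
      exact Matrix.one_apply_eq _
  · push Not at h
    obtain ⟨i, hi, hx⟩ := h
    rw [mul_zero]
    refine Finset.prod_eq_zero (Finset.mem_univ i) ?_
    rw [if_neg hi]
    exact Matrix.one_apply_ne hx

/-- The projection onto the bit strings vanishing off `S`. -/
def projOn (S : Finset (Fin n)) : Bits n →+ Bits n :=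
  AddMonoidHom.mk' (fun x j => if j ∈ S then x j else 0) fun x y => by
    ext j
    by_cases h : j ∈ S <;> simp [h]

lemma projOn_apply (S : Finset (Fin n)) (x : Bits n) (j : Fin n) :
    projOn S x j = if j ∈ S then x j else 0 := rfl

lemma projOn_of_forall {S : Finset (Fin n)} {x : Bits n} (h : ∀ i ∉ S, x i = 0) :
    projOn S x = x := by
  ext j
  rw [projOn_apply]
  split_ifs with hj
  · rfl
  · exact (h j hj).symm

lemma projOn_off (S : Finset (Fin n)) (x : Bits n) : ∀ i ∉ S, projOn S x i = 0 :=
  fun i hi => by rw [projOn_apply, if_neg hi]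

/-- The phases that make the vector `φ` constant on the bit strings vanishing off `S`. -/
def flatPhase (S : Finset (Fin n)) (φ : Vec n) : Bits n → ℂ := fun x => φ 0 / φ (projOn S x)

section Flat

variable {S : Finset (Fin n)} {φ : Vec n}

lemma IsQuadOn.apply_zero (h : IsQuadOn S φ) : φ 0 ≠ 0 := (h.ne_zero_iff 0).2 fun _ _ => rfl

lemma IsQuadOn.apply_projOn (h : IsQuadOn S φ) (x : Bits n) : φ (projOn S x) ≠ 0 :=
  (h.ne_zero_iff _).2 (projOn_off S x)

lemma IsQuadOn.flatPhase_ne_zero (h : IsQuadOn S φ) (x : Bits n) : flatPhase S φ x ≠ 0 :=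
  div_ne_zero h.apply_zero (h.apply_projOn x)

lemma IsQuadOn.flatPhase_shift (h : IsQuadOn S φ) (v : Bits n) :
    ∃ (c : ℂ) (χ : AddChar (Bits n) ℂ), c ^ 4 = 1 ∧
      ∀ x, flatPhase S φ (x + v) = c * χ x * flatPhase S φ x := by
  obtain ⟨c, χ, hc, hχ⟩ := h.shift _ (projOn_off S v)
  refine ⟨c⁻¹, χ.compAddMonoidHom (projOn S), by rw [inv_pow, hc, inv_one], fun x => ?_⟩
  have hc0 := ne_zero_of_pow_four hc
  have h1 := h.apply_projOn x
  have h2 := char_ne_zero χ (projOn S x)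
  rw [flatPhase, flatPhase, map_add, hχ, AddChar.compAddMonoidHom_apply]
  field_simp
  linear_combination (-φ 0) * char_sq χ (projOn S x)

lemma IsQuadOn.isClifford_flatPhase (h : IsQuadOn S φ) :
    IsClifford (Matrix.diagonal (flatPhase S φ)) := by
  refine isClifford_diagonal (fun x => ?_) fun v => ?_
  -- Shifting from `0`, where the phase is `1`, to `x` shows that its value at `x` is a fourth root
  -- of unity.
  · obtain ⟨c, χ, hc, hχ⟩ := h.flatPhase_shift x
    have h0 := hχ 0
    have h1 : flatPhase S φ 0 = 1 := by
      rw [flatPhase, map_zero, div_self h.apply_zero]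
    rw [zero_add, AddChar.map_zero_eq_one, h1, mul_one, mul_one] at h0
    rw [h0]
    exact (IsOfFinOrder.norm_eq_one (isOfFinOrder_iff_pow_eq_one.2 ⟨4, by norm_num, hc⟩))
  · obtain ⟨c, χ, -, hχ⟩ := h.flatPhase_shift v
    exact ⟨c, χ, hχ⟩

lemma IsQuadOn.flat_mulVec (h : IsQuadOn S φ) :
    Matrix.diagonal (flatPhase S φ) *ᵥ φ = φ 0 • indVec S := by
  ext x
  rw [Matrix.mulVec_diagonal, Pi.smul_apply, smul_eq_mul, indVec]
  split_ifs with hx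
  · rw [flatPhase, projOn_of_forall hx, mul_one, div_mul_cancel₀ _ ((h.ne_zero_iff x).2 hx)]
  · rw [not_not.1 (mt (h.ne_zero_iff x).1 hx), mul_zero, mul_zero]

lemma IsQuadOn.flat_mulVec_isQuadOn (h : IsQuadOn S φ) {φ' : Vec n} (h' : IsQuadOn S φ') :
    IsQuadOn S (Matrix.diagonal (flatPhase S φ) *ᵥ φ') := by
  constructor
  · intro x
    rw [Matrix.mulVec_diagonal, ← h'.ne_zero_iff, ne_eq, mul_eq_zero,
      or_iff_right (h.flatPhase_ne_zero x)]
  · intro p hp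
    obtain ⟨c, χ, hc, hχ⟩ := h.flatPhase_shift p
    obtain ⟨c', χ', hc', hχ'⟩ := h'.shift p hp
    refine ⟨c * c', χ * χ', by rw [mul_pow, hc, hc', one_mul], fun x => ?_⟩
    rw [Matrix.mulVec_diagonal, Matrix.mulVec_diagonal, hχ, hχ', AddChar.mul_apply]
    ring

end Flat

/-- Every stabilizer vector is Clifford equivalent to `|0⟩`. -/
lemma IsStab.exists_clifford {φ : Vec n} (h : IsStab φ) :
    ∃ U : Op n, IsClifford U ∧ ∃ c : ℂ, c ≠ 0 ∧ U *ᵥ φ = c • basisVec 0 := by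
  obtain ⟨⟨S, T, d, m⟩, hQ, -⟩ := h.exists_key
  dsimp only at hQ
  obtain ⟨c, hc, hH⟩ := hadamardOn_mulVec_basisVec_zero S
  refine ⟨hadamardOn S * (Matrix.diagonal (flatPhase S (frameOp S T d *ᵥ φ)) * frameOp S T d),
    (isClifford_hadamardOn S).mul (hQ.isClifford_flatPhase.mul (isClifford_frameOp S T d)),
    (frameOp S T d *ᵥ φ) 0 * c⁻¹, mul_ne_zero hQ.apply_zero (inv_ne_zero hc), ?_⟩
  -- The Hadamard gates are an involution taking `|0⟩` to the indicator up to a scalar, so they also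
  -- take the indicator back.
  have h1 : indVec S = c⁻¹ • hadamardOn S *ᵥ basisVec 0 := by
    rw [hH, smul_smul, inv_mul_cancel₀ hc, one_smul]
  rw [← Matrix.mulVec_mulVec, ← Matrix.mulVec_mulVec, hQ.flat_mulVec, h1, Matrix.mulVec_smul,
    Matrix.mulVec_smul, Matrix.mulVec_mulVec, hadamardOn_mul_self, Matrix.one_mulVec, smul_smul]

/-- The permutation of the qubits by `σ`. -/
def coordPerm (σ : Equiv.Perm (Fin n)) : Bits n ≃+ Bits n where
  toFun x := fun i => x (σ.symm i)
  invFun x := fun i => x (σ i)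
  left_inv x := by simp
  right_inv x := by simp
  map_add' _ _ := rfl

lemma permOp_coordPerm_mulVec (σ : Equiv.Perm (Fin n)) (φ : Vec n) (x : Bits n) :
    (permOp (coordPerm σ) *ᵥ φ) x = φ fun i => x (σ i) := permOp_mulVec _ _ _

lemma unitBit_perm (σ : Equiv.Perm (Fin n)) (i : Fin n) :
    (fun j => unitBit (σ i) (σ j)) = unitBit i := by
  ext j
  by_cases h : j = i
  · rw [h, unitBit_same, unitBit_same]
  · rw [unitBit_of_ne h, unitBit_of_ne fun e => h (σ.injective e)]

lemma IsQuadOn.perm {S S' : Finset (Fin n)} {φ : Vec n} (h : IsQuadOn S φ)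
    (σ : Equiv.Perm (Fin n)) (hσ : ∀ i, σ i ∈ S' ↔ i ∈ S) :
    IsQuadOn S' (permOp (coordPerm σ) *ᵥ φ) := by
  have key : ∀ x : Bits n, (∀ i ∉ S, x (σ i) = 0) ↔ ∀ i ∉ S', x i = 0 := fun x =>
    ⟨fun hx i hi => by
      have := hx (σ.symm i) (by rw [← hσ]; simpa using hi)
      simpa using this, fun hx i hi => hx _ (by rwa [hσ])⟩
  constructor
  · intro x
    rw [permOp_coordPerm_mulVec, h.ne_zero_iff, key]
  · intro p hp
    obtain ⟨c, χ, hc, hχ⟩ := h.shift (fun i => p (σ i)) ((key p).2 hp)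
    refine ⟨c, χ.compAddMonoidHom (coordPerm σ).symm.toAddMonoidHom, hc, fun x => ?_⟩
    rw [permOp_coordPerm_mulVec, permOp_coordPerm_mulVec]
    exact hχ _

/-- The first `k` qubits. -/
def firstQubits (n k : ℕ) : Finset (Fin n) := Finset.univ.filter fun i => (i : ℕ) < k

lemma mem_firstQubits {k : ℕ} {i : Fin n} : i ∈ firstQubits n k ↔ (i : ℕ) < k := by
  simp [firstQubits]

lemma exists_perm_firstQubits (S : Finset (Fin n)) :
    ∃ σ : Equiv.Perm (Fin n), ∀ i, σ i ∈ firstQubits n S.card ↔ i ∈ S := by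
  have hle : S.card ≤ n := by simpa using S.card_le_univ
  have hcard : (firstQubits n S.card).card = S.card := by
    rw [firstQubits, Fin.card_filter_val_lt, min_eq_right hle]
  let e : {i // i ∈ S} ≃ {i // i ∈ firstQubits n S.card} :=
    Fintype.equivOfCardEq (by simp [hcard])
  exact ⟨e.extendSubtype, fun i =>
    ⟨fun h => by_contra fun hi => e.extendSubtype_not_mem i hi h, e.extendSubtype_mem i⟩⟩

/-- Two states with the same key relative to a Clifford frame that takes the first state to `|0⟩`
become an indicator vector and a vector with equal values at `0` and at the unit strings. -/
lemma exists_common_frame {φ₀ φ₁ φ₂ : Vec n} {κ : FrameKey n} {U : Op n} (hU : IsClifford U)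
    (h0 : ∃ c : ℂ, c ≠ 0 ∧ U *ᵥ φ₀ = c • basisVec 0)
    (h1 : HasKey (U *ᵥ φ₁) κ) (h2 : HasKey (U *ᵥ φ₂) κ) :
    ∃ (U' : Op n) (k : ℕ) (z : Bits n), IsClifford U' ∧ k ≤ n ∧
      (∀ i ∈ firstQubits n k, z i = 0) ∧
      (∃ c : ℂ, c ≠ 0 ∧ U' *ᵥ φ₀ = c • basisVec z) ∧
      (∃ c : ℂ, c ≠ 0 ∧ U' *ᵥ φ₁ = c • indVec (firstQubits n k)) ∧
      IsQuadOn (firstQubits n k) (U' *ᵥ φ₂) ∧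
      ∀ i ∈ firstQubits n k, (U' *ᵥ φ₂) (unitBit i) = (U' *ᵥ φ₂) 0 := by
  obtain ⟨S, T, d, m⟩ := κ
  obtain ⟨hQ1, hm1⟩ := h1
  obtain ⟨hQ2, hm2⟩ := h2
  dsimp only at hQ1 hm1 hQ2 hm2
  obtain ⟨σ, hσ⟩ := exists_perm_firstQubits S
  obtain ⟨c, hc, h0⟩ := h0
  have hQ1' := hQ1.perm σ hσ
  have hQ2' := hQ2.perm σ hσ
  set P := permOp (coordPerm σ) with hP
  set F := frameOp S T d with hF
  set S' := firstQubits n S.card with hS'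
  set D := Matrix.diagonal (flatPhase S' (P *ᵥ (F *ᵥ (U *ᵥ φ₁)))) with hD
  have hmul : ∀ φ : Vec n, (D * (P * (F * U))) *ᵥ φ = D *ᵥ (P *ᵥ (F *ᵥ (U *ᵥ φ))) := fun φ => by
    simp only [← Matrix.mulVec_mulVec]
  have hzero : (coordPerm σ).symm (0 : Bits n) = 0 := map_zero _
  refine ⟨D * (P * (F * U)), S.card, coordPerm σ (padOff S d),
    hQ1'.isClifford_flatPhase.mul ((isClifford_permOp _).mul ((isClifford_frameOp S T d).mul hU)),
    by simpa using S.card_le_univ, fun i hi => ?_, ?_, ?_, ?_, ?_⟩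
  · refine padOff_of_mem S d ?_
    rw [← hσ]
    simpa using hi
  · refine ⟨c * flatPhase S' (P *ᵥ (F *ᵥ (U *ᵥ φ₁))) (coordPerm σ (padOff S d)),
      mul_ne_zero hc (hQ1'.flatPhase_ne_zero _), ?_⟩
    rw [hmul, h0, Matrix.mulVec_smul, Matrix.mulVec_smul, Matrix.mulVec_smul,
      frameOp_mulVec_basisVec_zero, permOp_mulVec_basisVec, diagonal_mulVec_basisVec, smul_smul]
  · rw [hmul]
    exact ⟨_, hQ1'.apply_zero, hQ1'.flat_mulVec⟩
  · rw [hmul]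
    exact hQ1'.flat_mulVec_isQuadOn hQ2'
  · intro i hi
    have hi' : σ.symm i ∈ S := by
      rw [← hσ]
      simpa using hi
    have hval : ∀ φ : Vec n, (P *ᵥ φ) (unitBit i) = φ (unitBit (σ.symm i)) := fun φ => by
      rw [hP, permOp_coordPerm_mulVec, ← unitBit_perm σ (σ.symm i), Equiv.apply_symm_apply]
    have hval0 : ∀ φ : Vec n, (P *ᵥ φ) 0 = φ 0 := fun φ => by
      rw [hP, permOp_coordPerm_mulVec]
      rfl
    have hp : projOn S' (unitBit i) = unitBit i :=
      projOn_of_forall fun j hj => unitBit_of_ne fun e => hj (e ▸ hi)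
    have hz1 := hQ1.apply_zero
    have hI : Complex.I ^ (m ⟨σ.symm i, hi'⟩ : ℕ) ≠ 0 := pow_ne_zero _ Complex.I_ne_zero
    -- Flattening divides by the values of the first vector. Both vectors have the same ratio `i^m`
    -- between this unit string and `0`, so the ratio cancels.
    rw [hmul, hD, Matrix.mulVec_diagonal, Matrix.mulVec_diagonal, flatPhase, flatPhase, hp,
      map_zero, hval, hval, hval0, hval0, hm1 ⟨_, hi'⟩, hm2 ⟨_, hi'⟩]
    field_simp

/-! ### Graph states -/

open Classical in
/-- A function of vertex sets that changes sign with each edge counts edges. -/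
lemma eq_neg_one_pow_edges {k : ℕ} (G : SimpleGraph (Fin k)) (f : Finset (Fin k) → ℂ)
    (hf : ∀ (i : Fin k) (A : Finset (Fin k)), i ∉ A →
      f (insert i A) = (∏ j ∈ A, if G.Adj i j then (-1 : ℂ) else 1) * f A)
    (A : Finset (Fin k)) :
    f A = f ∅ * (-1) ^ (Finset.univ.filter fun e : Fin k × Fin k =>
      e.1 < e.2 ∧ G.Adj e.1 e.2 ∧ e.1 ∈ A ∧ e.2 ∈ A).card := by
  -- Adding the largest vertex makes the new edges exactly the ordered pairs `(j, i)` with `j` a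
  -- neighbour in `A`.
  induction A using Finset.induction_on_max with
  | empty => simp
  | insert i A hlt ih =>
    have hi : i ∉ A := fun h => lt_irrefl _ (hlt i h)
    have hsplit : (Finset.univ.filter fun e : Fin k × Fin k =>
        e.1 < e.2 ∧ G.Adj e.1 e.2 ∧ e.1 ∈ insert i A ∧ e.2 ∈ insert i A) =
        (Finset.univ.filter fun e : Fin k × Fin k =>
          e.1 < e.2 ∧ G.Adj e.1 e.2 ∧ e.1 ∈ A ∧ e.2 ∈ A) ∪
        (A.filter fun j => G.Adj i j).image fun j => (j, i) := by
      ext ⟨a, b⟩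
      simp only [Finset.mem_filter, Finset.mem_univ, true_and, Finset.mem_union,
        Finset.mem_image, Finset.mem_insert, Prod.mk.injEq]
      constructor
      · rintro ⟨hab, hadj, rfl | ha, rfl | hb⟩
        · exact absurd hab (lt_irrefl _)
        · exact absurd (hlt b hb) hab.not_gt
        · exact Or.inr ⟨a, ⟨ha, hadj.symm⟩, rfl, rfl⟩
        · exact Or.inl ⟨hab, hadj, ha, hb⟩
      · rintro (⟨hab, hadj, ha, hb⟩ | ⟨j, ⟨hj, hadj⟩, rfl, rfl⟩)
        · exact ⟨hab, hadj, Or.inr ha, Or.inr hb⟩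
        · exact ⟨hlt _ hj, hadj.symm, Or.inr hj, Or.inl rfl⟩
    have hdisj : Disjoint (Finset.univ.filter fun e : Fin k × Fin k =>
        e.1 < e.2 ∧ G.Adj e.1 e.2 ∧ e.1 ∈ A ∧ e.2 ∈ A)
        ((A.filter fun j => G.Adj i j).image fun j => (j, i)) := by
      rw [Finset.disjoint_left]
      rintro e he he'
      obtain ⟨j, -, rfl⟩ := Finset.mem_image.1 he'
      exact hi (Finset.mem_filter.1 he).2.2.2.2
    rw [hf i A hi, ih, hsplit, Finset.card_union_of_disjoint hdisj,
      Finset.card_image_of_injective _ fun a b h => (Prod.mk.inj h).1, pow_add,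
      Finset.prod_ite, Finset.prod_const, Finset.prod_const_one]
    ring

section Graph

variable {k : ℕ} {ρ : Vec n}

lemma unitBit_off {S : Finset (Fin n)} {i : Fin n} (hi : i ∈ S) : ∀ j ∉ S, unitBit i j = 0 :=
  fun _ hj => unitBit_of_ne fun e => hj (e ▸ hi)

/-- Equal values at `0` and at the unit string force the constant of the shift to be `1`. Composing
with `projOn S` changes nothing on the support and makes the character trivial off `S`, so that
`Z^χ` will fix the basis state `|z⟩`. -/
lemma IsQuadOn.exists_char {S : Finset (Fin n)} (h : IsQuadOn S ρ) {i : Fin n} (hi : i ∈ S)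
    (h1 : ρ (unitBit i) = ρ 0) :
    ∃ χ : AddChar (Bits n) ℂ, (∀ x, ρ (x + unitBit i) = χ x * ρ x) ∧
      ∀ z : Bits n, (∀ j ∈ S, z j = 0) → χ z = 1 := by
  obtain ⟨c, χ, hc, hχ⟩ := h.shift _ (unitBit_off hi)
  have hc1 : c = 1 := by
    have h0 := hχ 0
    rw [zero_add, h1, AddChar.map_zero_eq_one, mul_one] at h0
    exact (mul_eq_right₀ h.apply_zero).1 h0.symm
  refine ⟨χ.compAddMonoidHom (projOn S), fun x => ?_, fun z hz => ?_⟩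
  · rw [hχ, hc1, one_mul, AddChar.compAddMonoidHom_apply]
    by_cases hx : ∀ j ∉ S, x j = 0
    · rw [projOn_of_forall hx]
    · rw [not_not.1 (mt (h.ne_zero_iff x).1 hx), mul_zero, mul_zero]
  · have : projOn S z = 0 := by
      ext j
      rw [projOn_apply]
      split_ifs with hj
      · exact hz j hj
      · rfl
    rw [AddChar.compAddMonoidHom_apply, this, AddChar.map_zero_eq_one]

/-- The characters by which a flat quadratic vector changes under translation by unit strings. -/
structure HasChars (S : Finset (Fin n)) (ρ : Vec n) (χ : Fin n → AddChar (Bits n) ℂ) : Prop where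
  shift : ∀ i ∈ S, ∀ x, ρ (x + unitBit i) = χ i x * ρ x
  eq_one : ∀ i ∈ S, ∀ z : Bits n, (∀ j ∈ S, z j = 0) → χ i z = 1
  zero : ρ 0 ≠ 0

lemma IsQuadOn.exists_hasChars {S : Finset (Fin n)} (h : IsQuadOn S ρ)
    (h1 : ∀ i ∈ S, ρ (unitBit i) = ρ 0) : ∃ χ, HasChars S ρ χ := by
  choose! χ h2 h3 using fun i hi => h.exists_char hi (h1 i hi)
  exact ⟨χ, h2, h3, h.apply_zero⟩

variable {S : Finset (Fin n)} {χ : Fin n → AddChar (Bits n) ℂ}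

lemma HasChars.unit (h : HasChars S ρ χ) {i : Fin n} (hi : i ∈ S) : ρ (unitBit i) = ρ 0 := by
  have := h.shift i hi 0
  rwa [zero_add, AddChar.map_zero_eq_one, one_mul] at this

/-- Reach `unitBit i + unitBit j` from `0` in both orders. -/
lemma HasChars.symm (h : HasChars S ρ χ) {i j : Fin n} (hi : i ∈ S) (hj : j ∈ S) :
    χ i (unitBit j) = χ j (unitBit i) := by
  have h1 := h.shift i hi (unitBit j)
  have h2 := h.shift j hj (unitBit i)
  rw [add_comm, h2, h.unit hi, h.unit hj] at h1
  exact (mul_right_cancel₀ h.zero h1).symm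

/-- Shifting twice by the same unit string returns to `0`. This excludes loops, and it makes `Z^(χ
i)` commute with `X_i`. -/
lemma HasChars.self (h : HasChars S ρ χ) {i : Fin n} (hi : i ∈ S) : χ i (unitBit i) = 1 := by
  have h1 := h.shift i hi (unitBit i)
  rw [add_self_bits, h.unit hi] at h1
  exact (mul_eq_right₀ h.zero).1 h1.symm

/-- The graph whose edges are the anticommuting pairs. -/
def HasChars.graph (hk : k ≤ n) (h : HasChars (firstQubits n k) ρ χ) : SimpleGraph (Fin k) where
  Adj i j := χ (Fin.castLE hk i) (unitBit (Fin.castLE hk j)) = -1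
  symm := ⟨fun i j hij => by
    rw [h.symm (mem_firstQubits.2 j.2) (mem_firstQubits.2 i.2)]
    exact hij⟩
  loopless := ⟨fun i hi => by
    rw [h.self (mem_firstQubits.2 i.2)] at hi
    norm_num at hi⟩

lemma HasChars.eq_graphVec (hk : k ≤ n) (h : HasChars (firstQubits n k) ρ χ)
    (hsupp : ∀ x, ρ x ≠ 0 ↔ ∀ i ∉ firstQubits n k, x i = 0) :
    ρ = ρ 0 • padZero hk (graphVec (h.graph hk)) := by
  classical
  have hout : ∀ x : Bits n, (∀ i ∉ firstQubits n k, x i = 0) ↔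
      ∀ i : Fin n, k ≤ (i : ℕ) → x i = 0 := fun x => by
    simp only [mem_firstQubits, not_lt]
  ext x
  rw [Pi.smul_apply, smul_eq_mul, padZero]
  split_ifs with hx
  -- Build `x` from the unit strings at its ones: adding vertex `i` to a set `A` multiplies the
  -- value by `χ i` of the sum over `A`, one sign for each neighbour of `i`.
  · have h1 := eq_neg_one_pow_edges (h.graph hk)
      (fun A => ρ (∑ i ∈ A, unitBit (Fin.castLE hk i))) (fun i A hi => by
        rw [Finset.sum_insert hi, add_comm, h.shift _ (mem_firstQubits.2 i.2), char_sum]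
        congr 1
        refine Finset.prod_congr rfl fun j _ => ?_
        change _ = if χ (Fin.castLE hk i) (unitBit (Fin.castLE hk j)) = -1 then (-1 : ℂ) else 1
        split_ifs with hc
        · exact hc
        · exact (char_cases _ _).resolve_right hc)
      (Finset.univ.filter fun i : Fin k => x (Fin.castLE hk i) = 1)
    have hsum : ∑ i ∈ Finset.univ.filter (fun i : Fin k => x (Fin.castLE hk i) = 1),
        unitBit (Fin.castLE hk i) = x := by
      ext j
      rw [Finset.sum_apply]
      by_cases hj : (j : ℕ) < k
      · have hjk : Fin.castLE hk ⟨j, hj⟩ = j := rfl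
        rcases zmod_two_cases (x j) with h0 | h0
        · rw [h0]
          refine Finset.sum_eq_zero fun i hi => unitBit_of_ne ?_
          rintro rfl
          rw [(Finset.mem_filter.1 hi).2] at h0
          exact one_ne_zero h0
        · rw [h0, Finset.sum_eq_single ⟨j, hj⟩]
          · rw [hjk, unitBit_same]
          · intro i _ hi
            refine unitBit_of_ne ?_
            rintro rfl
            exact hi rfl
          · intro hn
            exact absurd (Finset.mem_filter.2 ⟨Finset.mem_univ _, by rw [hjk, h0]⟩) hn
      · rw [hx j (not_lt.1 hj)]
        refine Finset.sum_eq_zero fun i _ => unitBit_of_ne ?_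
        rintro rfl
        exact hj i.2
    rw [hsum, Finset.sum_empty] at h1
    rw [h1, graphVec]
    simp only [Finset.mem_filter, Finset.mem_univ, true_and]
  · rw [mul_zero]
    rw [← hout] at hx
    exact not_not.1 (mt (hsupp x).1 hx)

lemma graphVec_bot : graphVec (⊥ : SimpleGraph (Fin k)) = 1 := by
  classical
  ext x
  simp [graphVec]

lemma indVec_eq_padZero (hk : k ≤ n) :
    indVec (firstQubits n k) = padZero hk (graphVec ⊥) := by
  classical
  ext x
  rw [indVec, padZero, graphVec_bot]
  refine if_congr ?_ rfl rfl
  simp only [mem_firstQubits, not_lt]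

end Graph

/-! ### Magic squares -/

/-- The four generators and the third state's two relations suffice: the third column consists of
products within rows, and all signs follow from the commutation relations. -/
lemma isMagicSquare_of {ψ : Fin 3 → PureState n} {A a B b : Op n}
    (hA : IsPauliObservable A) (ha : IsPauliObservable a) (hB : IsPauliObservable B)
    (hb : IsPauliObservable b) (hAa : A * a = a * A) (hBb : B * b = b * B)
    (hAB : A * B = B * A) (hab : a * b = b * a) (hAb : A * b = -(b * A)) (haB : a * B = -(B * a))
    (sA : Stabilizes A (ψ 0)) (sa : Stabilizes a (ψ 0)) (sB : Stabilizes B (ψ 1))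
    (sb : Stabilizes b (ψ 1)) (sAB : Stabilizes (A * B) (ψ 2)) (sab : Stabilizes (a * b) (ψ 2)) :
    IsMagicSquare ψ A a B b := by
  have smul : ∀ {O O' : Op n} {ψ : PureState n}, Stabilizes O ψ → Stabilizes O' ψ →
      Stabilizes (O * O') ψ := fun {O O' ψ} h h' => by
    rw [Stabilizes] at *
    rw [← Matrix.mulVec_mulVec, h', h]
  have pAa := hA.mul ha hAa
  have pBb := hB.mul hb hBb
  have pAB := hA.mul hB hAB
  have pab := ha.mul hb hab
  -- Two anticommutations occur, `a` with `B` and `A` with `b`, and their signs cancel.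
  have hcomm : A * B * (a * b) = a * b * (A * B) := by
    calc A * B * (a * b) = A * (B * a) * b := by simp only [mul_assoc]
      _ = -(A * a * (B * b)) := by
        rw [show B * a = -(a * B) by rw [haB, neg_neg], mul_neg, neg_mul]
        simp only [mul_assoc]
      _ = -(a * (A * b) * B) := by rw [hAa, hBb]; simp only [mul_assoc]
      _ = a * b * (A * B) := by rw [hAb, mul_neg, neg_mul, neg_neg]; simp only [mul_assoc]
  have pABab : IsPauliObservable (A * B * a * b) := by
    rw [mul_assoc (A * B)]
    exact pAB.mul pab hcomm
  have sq : ∀ {O : Op n}, IsPauliObservable O → O * O = 1 := fun h => (isPauliObservable_iff.1 h).1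
  -- Here only `a` and `B` are exchanged; this single sign is the `-1` of the third column.
  have hcol : A * a * (B * b) = -(A * B * a * b) := by
    calc A * a * (B * b) = A * (a * B) * b := by simp only [mul_assoc]
      _ = _ := by rw [haB, mul_neg, neg_mul]; simp only [mul_assoc]
  refine ⟨fun i j => ?_, fun i j => ?_, hAa, hBb, hAB, hab, hAb, haB, fun i => ?_, fun j => ?_⟩
  · fin_cases i <;> fin_cases j
    exacts [hA, ha, pAa, hB, hb, pBb, pAB, pab, pABab]
  · fin_cases i <;> fin_cases j
    exacts [sA, sa, smul sA sa, sB, sb, smul sB sb, sAB, sab, by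
      change Stabilizes (A * B * a * b) (ψ 2)
      rw [mul_assoc (A * B)]
      exact smul sAB sab]
  · fin_cases i
    · exact sq pAa
    · exact sq pBb
    · change A * B * (a * b) * (A * B * a * b) = 1
      rw [← mul_assoc (A * B) a b]
      exact sq pABab
  · fin_cases j
    · exact sq pAB
    · exact sq pab
    · change A * a * (B * b) * (A * B * a * b) = -1
      rw [hcol, neg_mul, sq pABab]

/-- A magic square may be exhibited after a Clifford unitary. -/
lemma exists_isMagicSquare_of_conj {ψ : Fin 3 → PureState n} {U : Op n} (hU : IsClifford U)
    {A a B b : Op n}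
    (hA : IsPauliObservable A) (ha : IsPauliObservable a) (hB : IsPauliObservable B)
    (hb : IsPauliObservable b) (hAa : A * a = a * A) (hBb : B * b = b * B)
    (hAB : A * B = B * A) (hab : a * b = b * a) (hAb : A * b = -(b * A)) (haB : a * B = -(B * a))
    (sA : A *ᵥ (U *ᵥ (ψ 0).rep) = U *ᵥ (ψ 0).rep) (sa : a *ᵥ (U *ᵥ (ψ 0).rep) = U *ᵥ (ψ 0).rep)
    (sB : B *ᵥ (U *ᵥ (ψ 1).rep) = U *ᵥ (ψ 1).rep) (sb : b *ᵥ (U *ᵥ (ψ 1).rep) = U *ᵥ (ψ 1).rep)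
    (sAB : (A * B) *ᵥ (U *ᵥ (ψ 2).rep) = U *ᵥ (ψ 2).rep)
    (sab : (a * b) *ᵥ (U *ᵥ (ψ 2).rep) = U *ᵥ (ψ 2).rep) :
    ∃ A a B b : Op n, IsMagicSquare ψ A a B b := by
  have hm : ∀ O O' : Op n, Uᴴ * O * U * (Uᴴ * O' * U) = Uᴴ * (O * O') * U := fun O O' => by
    calc Uᴴ * O * U * (Uᴴ * O' * U) = Uᴴ * O * (U * Uᴴ) * O' * U := by simp only [mul_assoc]
      _ = _ := by rw [hU.mul_conjTranspose, mul_one]; simp only [mul_assoc]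
  have hs : ∀ {O : Op n} {ψ : PureState n}, O *ᵥ (U *ᵥ ψ.rep) = U *ᵥ ψ.rep →
      Stabilizes (Uᴴ * O * U) ψ := fun {O ψ} h => by
    rw [Stabilizes, ← Matrix.mulVec_mulVec, ← Matrix.mulVec_mulVec, h, hU.mulVec_cancel]
  have hc : ∀ {O O' : Op n}, O * O' = O' * O →
      Uᴴ * O * U * (Uᴴ * O' * U) = Uᴴ * O' * U * (Uᴴ * O * U) := fun h => by
    rw [hm, hm, h]
  have han : ∀ {O O' : Op n}, O * O' = -(O' * O) →
      Uᴴ * O * U * (Uᴴ * O' * U) = -(Uᴴ * O' * U * (Uᴴ * O * U)) := fun h => by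
    rw [hm, hm, h, mul_neg, neg_mul]
  exact ⟨_, _, _, _, isMagicSquare_of (hU.isPauliObservable_conj_symm hA)
    (hU.isPauliObservable_conj_symm ha) (hU.isPauliObservable_conj_symm hB)
    (hU.isPauliObservable_conj_symm hb) (hc hAa) (hc hBb) (hc hAB) (hc hab) (han hAb) (han haB)
    (hs sA) (hs sa) (hs sB) (hs sb) (by rw [hm]; exact hs sAB) (by rw [hm]; exact hs sab)⟩

lemma eq_of_rep_eq_smul {ψ ψ' : PureState n} {c : ℂ} (h : ψ.rep = c • ψ'.rep) : ψ = ψ' := by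
  rw [← ψ.mk_rep, ← ψ'.mk_rep, Projectivization.mk_eq_mk_iff']
  exact ⟨c, h.symm⟩

/-- Two distinct states with the same key relative to a frame of a third state form, together with
the third state, a Mermin–Peres magic square of Clifford equivalent graph states. -/
theorem magicSquare_of_hasKey {ψ : Fin 3 → PureState n} {κ : FrameKey n} {U : Op n}
    (hU : IsClifford U) (h0 : ∃ c : ℂ, c ≠ 0 ∧ U *ᵥ (ψ 0).rep = c • basisVec 0)
    (h1 : HasKey (U *ᵥ (ψ 1).rep) κ) (h2 : HasKey (U *ᵥ (ψ 2).rep) κ) (hne : ψ 1 ≠ ψ 2) :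
    Function.Injective ψ ∧ CliffordEquivBasisGraphGraph ψ ∧
      ∃ A a B b : Op n, IsMagicSquare ψ A a B b := by
  obtain ⟨V, k, z, hV, hk, hz, ⟨c0, hc0, e0⟩, ⟨c1, hc1, e1⟩, hQ, hunit⟩ :=
    exists_common_frame hU h0 h1 h2
  obtain ⟨χ, hχ⟩ := hQ.exists_hasChars hunit
  have e2 := hχ.eq_graphVec hk hQ.ne_zero_iff
  -- Without an edge the graph state would be the flat indicator, and the two states would coincide.
  have hedge : ∃ i ∈ firstQubits n k, ∃ j ∈ firstQubits n k, χ i (unitBit j) = -1 := by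
    by_contra! hcon
    have hG : hχ.graph hk = ⊥ := by
      ext i j
      simp only [SimpleGraph.bot_adj, iff_false]
      exact hcon _ (mem_firstQubits.2 i.2) _ (mem_firstQubits.2 j.2)
    rw [hG, ← indVec_eq_padZero hk] at e2
    refine hne (eq_of_rep_eq_smul (c := c1 * ((V *ᵥ (ψ 2).rep) 0)⁻¹) (hV.mulVec_injective ?_))
    rw [Matrix.mulVec_smul, e1]
    have h3 : c1 • indVec (firstQubits n k) = (c1 * ((V *ᵥ (ψ 2).rep) 0)⁻¹) •
        ((V *ᵥ (ψ 2).rep) 0 • indVec (firstQubits n k)) := by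
      rw [smul_smul, mul_assoc, inv_mul_cancel₀ hχ.zero, mul_one]
    rwa [← e2] at h3
  obtain ⟨i, hi, j, hj, hij⟩ := hedge
  have hji : χ j (unitBit i) = -1 := by rw [← hχ.symm hi hj, hij]
  -- A basis state has one nonzero amplitude, whereas the two graph states are nonzero at both `0`
  -- and `unitBit i`.
  have hdist : ∀ {ψ' : PureState n}, (V *ᵥ ψ'.rep) 0 ≠ 0 → (V *ᵥ ψ'.rep) (unitBit i) ≠ 0 →
      ψ 0 ≠ ψ' := by
    rintro _ h0 hi rfl
    rw [e0, Pi.smul_apply, smul_eq_mul, basisVec, Pi.single_apply] at h0 hi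
    have hz0 : 0 = z := by by_contra h; simp [h] at h0
    have hzi : unitBit i = z := by by_contra h; simp [h] at hi
    have := congrFun (hz0.trans hzi.symm) i
    rw [unitBit_same] at this
    exact zero_ne_one this
  have h01 : ψ 0 ≠ ψ 1 := by
    have hind : ∀ x, (∀ i ∉ firstQubits n k, x i = 0) → (V *ᵥ (ψ 1).rep) x ≠ 0 := fun x hx => by
      rw [e1, Pi.smul_apply, smul_eq_mul, indVec, if_pos hx, mul_one]
      exact hc1
    exact hdist (hind _ fun _ _ => rfl) (hind _ (unitBit_off hi))
  have h02 : ψ 0 ≠ ψ 2 := hdist hχ.zero ((hQ.ne_zero_iff _).2 (unitBit_off hi))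
  refine ⟨?_, ⟨V, hV, ⟨z, c0, hc0, e0⟩, k, hk, ⊥, hχ.graph hk,
    ⟨c1, hc1, ?_⟩, ⟨_, hχ.zero, e2⟩⟩, ?_⟩
  · intro a b hab
    fin_cases a <;> fin_cases b <;>
      first
      | rfl
      | exact absurd hab h01
      | exact absurd hab.symm h01
      | exact absurd hab h02
      | exact absurd hab.symm h02
      | exact absurd hab hne
      | exact absurd hab.symm hne
  · rw [e1, indVec_eq_padZero hk]
  · have hone : ∀ v : Bits n, (1 : AddChar (Bits n) ℂ) v = 1 := fun v => rfl
    have hZ : ∀ i ∈ firstQubits n k,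
        weyl 0 (χ i) *ᵥ (V *ᵥ (ψ 0).rep) = V *ᵥ (ψ 0).rep := fun i hi => by
      rw [e0, Matrix.mulVec_smul]
      congr 1
      ext x
      rw [weyl_mulVec, add_zero, basisVec, Pi.single_apply]
      split_ifs with hx
      · rw [hx, hχ.eq_one i hi z hz, one_mul]
      · rw [mul_zero]
    have hX : ∀ i ∈ firstQubits n k,
        weyl (unitBit i) 1 *ᵥ (V *ᵥ (ψ 1).rep) = V *ᵥ (ψ 1).rep := fun i hi => by
      rw [e1, Matrix.mulVec_smul]
      congr 1
      ext x
      rw [weyl_mulVec, hone, one_mul, indVec, indVec]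
      refine if_congr (forall₂_congr fun l hl => ?_) rfl rfl
      rw [Pi.add_apply, unitBit_off hi l hl, add_zero]
    have hXZ : ∀ i ∈ firstQubits n k,
        (weyl 0 (χ i) * weyl (unitBit i) 1) *ᵥ (V *ᵥ (ψ 2).rep) = V *ᵥ (ψ 2).rep := fun i hi => by
      ext x
      rw [← Matrix.mulVec_mulVec, weyl_mulVec, weyl_mulVec, add_zero, hone, one_mul,
        hχ.shift i hi, ← mul_assoc, char_sq, one_mul]
    -- `Z^χ` and `X^v` commute up to the sign `χ v`, so the relations reduce to `χ i (unitBit i) =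
    -- 1` (no loops) and `χ i (unitBit j) = -1` (the edge).
    refine exists_isMagicSquare_of_conj hV (A := weyl 0 (χ i)) (a := weyl 0 (χ j))
      (B := weyl (unitBit i) 1) (b := weyl (unitBit j) 1)
      (isPauliObservable_weyl (AddChar.map_zero_eq_one _))
      (isPauliObservable_weyl (AddChar.map_zero_eq_one _))
      (isPauliObservable_weyl rfl) (isPauliObservable_weyl rfl) ?_ ?_ ?_ ?_ ?_ ?_
      (hZ i hi) (hZ j hj) (hX i hi) (hX j hj) (hXZ i hi) (hXZ j hj)
    · rw [weyl_mul, weyl_mul, AddChar.map_zero_eq_one, AddChar.map_zero_eq_one, mul_comm (χ i)]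
    · rw [weyl_mul, weyl_mul, hone, hone, add_comm]
    · rw [weyl_mul, weyl_mul, hχ.self hi, hone, add_comm, mul_comm (χ i)]
    · rw [weyl_mul, weyl_mul, hχ.self hj, hone, add_comm, mul_comm (χ j)]
    · rw [weyl_mul, weyl_mul, hij, hone, add_comm, mul_comm (χ i), neg_smul]
    · rw [weyl_mul, weyl_mul, hji, hone, add_comm, mul_comm (χ j), neg_smul]

/-! ### Counting keys -/

lemma card_frameKey : Fintype.card (FrameKey n) =
    ∑ S : Finset (Fin n), 2 ^ ((n - S.card) * S.card) * (2 ^ (n - S.card) * 4 ^ S.card) := by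
  rw [Fintype.card_sigma]
  refine Finset.sum_congr rfl fun S _ => ?_
  have h1 : Fintype.card {j // j ∉ S} = n - S.card := by
    rw [Fintype.card_subtype_compl, Fintype.card_fin, Fintype.card_coe]
  rw [Fintype.card_prod, Fintype.card_prod, Fintype.card_fun, Fintype.card_fun, Fintype.card_fun,
    Fintype.card_prod, h1, Fintype.card_coe, ZMod.card, Fintype.card_fin]

/-- With `k = |S|`, `k(n-k) ≤ n²/4`; the remaining factors sum to `(4 + 2)^n` by the binomial
theorem, and `6 ≤ 2^3` leaves room below `2^(7/2)`. -/
lemma card_frameKey_le :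
    (Fintype.card (FrameKey n) : ℝ) ≤ (2 : ℝ) ^ ((n : ℝ) ^ 2 / 4 + 7 * (n : ℝ) / 2) := by
  have hterm : ∀ S : Finset (Fin n),
      (2 : ℝ) ^ ((n - S.card) * S.card) ≤ (2 : ℝ) ^ ((n : ℝ) ^ 2 / 4) := fun S => by
    have hle : S.card ≤ n := by simpa using S.card_le_univ
    rw [← Real.rpow_natCast]
    refine Real.rpow_le_rpow_of_exponent_le (by norm_num) ?_
    push_cast [Nat.cast_sub hle]
    nlinarith [sq_nonneg ((n : ℝ) - 2 * S.card)]
  have hsum : ∑ S : Finset (Fin n), (2 : ℝ) ^ (n - S.card) * 4 ^ S.card = 6 ^ n := by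
    have := Finset.sum_pow_mul_eq_add_pow (4 : ℝ) 2 (Finset.univ : Finset (Fin n))
    rw [Finset.powerset_univ, Finset.card_univ, Fintype.card_fin] at this
    rw [show (6 : ℝ) = 4 + 2 by norm_num, ← this]
    exact Finset.sum_congr rfl fun S _ => mul_comm _ _
  have h6 : (6 : ℝ) ^ n ≤ (2 : ℝ) ^ (7 * (n : ℝ) / 2) := by
    calc (6 : ℝ) ^ n ≤ 8 ^ n := by gcongr; norm_num
      _ = (2 : ℝ) ^ (3 * (n : ℝ)) := by
        rw [Real.rpow_mul (by norm_num), Real.rpow_natCast]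
        norm_num
      _ ≤ _ := Real.rpow_le_rpow_of_exponent_le (by norm_num) (by
        have : (0 : ℝ) ≤ n := n.cast_nonneg
        linarith)
  rw [card_frameKey, Real.rpow_add (by norm_num)]
  push_cast
  calc ∑ S : Finset (Fin n), (2 : ℝ) ^ ((n - S.card) * S.card) * (2 ^ (n - S.card) * 4 ^ S.card)
      ≤ ∑ S : Finset (Fin n), (2 : ℝ) ^ ((n : ℝ) ^ 2 / 4) * (2 ^ (n - S.card) * 4 ^ S.card) :=
        Finset.sum_le_sum fun S _ => mul_le_mul_of_nonneg_right (hterm S) (by positivity)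
    _ = (2 : ℝ) ^ ((n : ℝ) ^ 2 / 4) * 6 ^ n := by rw [← Finset.mul_sum, hsum]
    _ ≤ _ := mul_le_mul_of_nonneg_left h6 (by positivity)

/-! ### Hidden variables -/

namespace OntologicalTheory

variable {Λ : Type*} [Fintype Λ] (T : OntologicalTheory n Λ)

lemma probFrom_nonneg (h : History n) (l : Λ) : 0 ≤ T.probFrom h l := by
  induction h generalizing l with
  | nil => exact zero_le_one
  | cons m h ih =>
    exact mul_nonneg ((T.response_mem _ _).1 _)
      (Finset.sum_nonneg fun l' _ => mul_nonneg ((T.trans_mem _ _ _).1 _) (ih l'))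

lemma response_add (p : Fin n → Pauli) (l : Λ) (y : ℤˣ) :
    T.response p l y + T.response p l (-y) = 1 := by
  have h := (T.response_mem p l).2
  have hu : (Finset.univ : Finset ℤˣ) = {1, -1} := rfl
  rw [hu, Finset.sum_pair (by decide)] at h
  rcases Int.units_eq_one_or y with rfl | rfl
  · exact h
  · rw [neg_neg, add_comm]
    exact h

lemma probFrom_append (h : History n) (p : Fin n → Pauli) (y : ℤˣ) (l : Λ) :
    T.probFrom (h ++ [(p, y)]) l + T.probFrom (h ++ [(p, -y)]) l = T.probFrom h l := by
  induction h generalizing l with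
  | nil =>
    have hs : ∀ y, ∑ l', T.trans p y l l' = 1 := fun y => (T.trans_mem p y l).2
    simp only [List.nil_append, probFrom, mul_one, hs]
    exact T.response_add p l y
  | cons m h ih =>
    simp only [List.cons_append, probFrom]
    rw [← mul_add, ← Finset.sum_add_distrib]
    simp only [← mul_add, ih]

/-- The probability on `ψ` is a sum of nonnegative terms, so its vanishing kills the term of each
variable in the support. -/
lemma probFrom_eq_zero {T : OntologicalTheory n Λ} (hT : T.Simulates) {ψ : StabilizerState n}
    {l : Λ} (hl : l ∈ T.supp ψ) {h : History n} (hq : collapse h ψ.1.rep = 0) :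
    T.probFrom h l = 0 := by
  have h0 : T.prob ψ h = 0 := (hT ψ h).2 (by simp [quantumProb, hq])
  rw [prob, Finset.sum_eq_zero_iff_of_nonneg fun l _ =>
    mul_nonneg ((T.prep_mem ψ).1 l) (T.probFrom_nonneg h l)] at h0
  exact (mul_eq_zero.1 (h0 l (Finset.mem_univ l))).resolve_left hl

end OntologicalTheory

/-- The projection onto the outcome `+1` of an observable. -/
def outcomeProj (O : Op n) : Op n := (1 / 2 : ℂ) • (1 + O)

lemma collapse_cons_signed (ε y : ℤˣ) (p : Fin n → Pauli) (h : History n) (v : Vec n) :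
    collapse ((p, y * ε) :: h) v =
      collapse h (outcomeProj (((y : ℤ) : ℂ) • signedPauli ε p) *ᵥ v) := by
  rw [collapse, outcomeProj, signedPauli, signedPauli, smul_smul]
  push_cast
  rfl

lemma outcomeProj_of_neg {O : Op n} {v : Vec n} (h : O *ᵥ v = -v) :
    outcomeProj O *ᵥ v = 0 := by
  rw [outcomeProj, Matrix.smul_mulVec, Matrix.add_mulVec, Matrix.one_mulVec, h, add_neg_cancel,
    smul_zero]

lemma outcomeProj_mulVec_of_comm {O O' : Op n} (hc : O' * O = O * O') {v : Vec n} {c : ℂ}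
    (h : O' *ᵥ v = c • v) : O' *ᵥ (outcomeProj O *ᵥ v) = c • (outcomeProj O *ᵥ v) := by
  rw [outcomeProj, Matrix.mulVec_mulVec, Matrix.mul_smul, mul_add, hc, mul_one,
    ← Matrix.mulVec_smul, ← h, Matrix.mulVec_mulVec, Matrix.smul_mul, add_mul, one_mul]

lemma mulVec_outcomeProj {O : Op n} (hO : O * O = 1) (v : Vec n) :
    O *ᵥ (outcomeProj O *ᵥ v) = outcomeProj O *ᵥ v := by
  rw [outcomeProj, Matrix.mulVec_mulVec, Matrix.mul_smul, mul_add, mul_one, hO, add_comm]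

/-- States whose stabilizers form a magic square do not share a hidden variable. -/
theorem IsMagicSquare.disjoint_supp {Λ : Type*} [Fintype Λ] {T : OntologicalTheory n Λ}
    (hT : T.Simulates) {ψ : Fin 3 → StabilizerState n} {A a B b : Op n}
    (hM : IsMagicSquare (fun i => (ψ i).1) A a B b) (l : Λ) (hl : ∀ i, l ∈ T.supp (ψ i)) :
    False := by
  obtain ⟨ε₁, p₁, e₁⟩ := hM.pauli 0 2
  obtain ⟨ε₂, p₂, e₂⟩ := hM.pauli 1 2
  obtain ⟨ε₃, p₃, e₃⟩ := hM.pauli 2 2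
  have q₁ := (isPauliObservable_iff.1 (hM.pauli 0 2)).1
  have q₂ := (isPauliObservable_iff.1 (hM.pauli 1 2)).1
  have q₃ := (isPauliObservable_iff.1 (hM.pauli 2 2)).1
  have s₁ := hM.stabilizes 0 2
  have s₂ := hM.stabilizes 1 2
  have s₃ := hM.stabilizes 2 2
  have hcol := hM.col 2
  set O₁ := squareTable A a B b 0 2
  set O₂ := squareTable A a B b 1 2
  set O₃ := squareTable A a B b 2 2
  change O₁ * O₂ * O₃ = -1 at hcol
  have h12 : O₁ * O₂ = -O₃ := by
    have := congrArg (· * O₃) hcol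
    simpa only [mul_assoc, q₃, mul_one, neg_mul, one_mul] using this
  -- Since `O₃` squares to `1`, so does `O₁ * O₂`, whose inverse is `O₂ * O₁`; hence the two factors
  -- commute.
  have h21 : O₂ * O₁ = -O₃ := by
    have h : (O₁ * O₂) * (O₂ * O₁) = (O₁ * O₂) * -O₃ := by
      rw [mul_neg, hcol, neg_neg]
      calc O₁ * O₂ * (O₂ * O₁) = O₁ * (O₂ * O₂) * O₁ := by simp only [mul_assoc]
        _ = 1 := by rw [q₂, mul_one, q₁]
    have h3 := congrArg (fun X => -O₃ * X) h
    have h4 : -O₃ * (O₁ * O₂) = 1 := by rw [h12, neg_mul_neg, q₃]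
    simpa only [← mul_assoc, mul_assoc (-O₃) O₁ O₂, h4, one_mul] using h3
  have h32 : O₃ * O₂ = O₂ * O₃ := by
    have e : O₃ = -(O₁ * O₂) := by rw [h12, neg_neg]
    have e' : O₃ = -(O₂ * O₁) := by rw [h21, neg_neg]
    rw [show O₃ * O₂ = -(O₂ * O₁) * O₂ by rw [← e'], e]
    simp only [neg_mul, mul_neg, mul_assoc]
  have h31 : O₃ * O₁ = O₁ * O₃ := by
    have e : O₃ = -(O₁ * O₂) := by rw [h12, neg_neg]
    have e' : O₃ = -(O₂ * O₁) := by rw [h21, neg_neg]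
    rw [show O₃ * O₁ = -(O₁ * O₂) * O₁ by rw [← e], e']
    simp only [neg_mul, mul_neg, mul_assoc]
  have hplus : ∀ (ε : ℤˣ) (p : Fin n → Pauli) (h : History n) (v : Vec n),
      collapse ((p, ε) :: h) v = collapse h (outcomeProj (signedPauli ε p) *ᵥ v) :=
    fun ε p h v => rfl
  have hminus : ∀ (ε : ℤˣ) (p : Fin n → Pauli) (h : History n) (v : Vec n),
      collapse ((p, -ε) :: h) v = collapse h (outcomeProj (-signedPauli ε p) *ᵥ v) :=
    fun ε p h v => by
      have := collapse_cons_signed ε (-1) p h v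
      simpa using this
  -- Outcome `ε` of the string `p` is outcome `+1` of the observable `ε p`. The first state forbids
  -- `-1` for `O₁`; below, the second forbids it for `O₂` and the third for `O₃`, since the earlier
  -- projections commute with these observables.
  have k1 : T.probFrom [(p₁, -ε₁)] l = 0 := by
    refine OntologicalTheory.probFrom_eq_zero hT (hl 0) ?_
    rw [hminus, ← e₁]
    refine outcomeProj_of_neg ?_
    rw [Matrix.neg_mulVec, s₁]
  have k2 : T.probFrom [(p₁, ε₁), (p₂, -ε₂)] l = 0 := by
    refine OntologicalTheory.probFrom_eq_zero hT (hl 1) ?_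
    rw [hplus, hminus, ← e₁, ← e₂]
    refine outcomeProj_of_neg ?_
    have := outcomeProj_mulVec_of_comm (O := O₁) (O' := O₂) (h21.trans h12.symm) (c := 1)
      (v := (ψ 1).1.rep) (by rw [one_smul]; exact s₂)
    rw [Matrix.neg_mulVec, this, one_smul]
  have hw : O₃ *ᵥ (outcomeProj O₂ *ᵥ (outcomeProj O₁ *ᵥ (ψ 2).1.rep)) =
      outcomeProj O₂ *ᵥ (outcomeProj O₁ *ᵥ (ψ 2).1.rep) := by
    have h1 := outcomeProj_mulVec_of_comm (O := O₁) (O' := O₃) h31 (c := 1)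
      (v := (ψ 2).1.rep) (by rw [one_smul]; exact s₃)
    have h2 := outcomeProj_mulVec_of_comm (O := O₂) (O' := O₃) h32 h1
    rwa [one_smul] at h2
  have k3 : T.probFrom [(p₁, ε₁), (p₂, ε₂), (p₃, -ε₃)] l = 0 := by
    refine OntologicalTheory.probFrom_eq_zero hT (hl 2) ?_
    rw [hplus, hplus, hminus, ← e₁, ← e₂, ← e₃]
    refine outcomeProj_of_neg ?_
    rw [Matrix.neg_mulVec, hw]
  -- After outcomes `+1` for `O₁` and `O₂`, any vector is fixed by both, so `O₃ = -(O₁ * O₂)` has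
  -- value `-1`.
  have k4 : T.probFrom [(p₁, ε₁), (p₂, ε₂), (p₃, ε₃)] l = 0 := by
    refine OntologicalTheory.probFrom_eq_zero hT (hl 2) ?_
    rw [hplus, hplus, hplus, ← e₁, ← e₂, ← e₃]
    refine outcomeProj_of_neg ?_
    have h1 := mulVec_outcomeProj q₁ (ψ 2).1.rep
    have h2 := outcomeProj_mulVec_of_comm (O := O₂) (O' := O₁) (h12.trans h21.symm) (c := 1)
      (v := outcomeProj O₁ *ᵥ (ψ 2).1.rep) (by rw [one_smul]; exact h1)
    have h3 := mulVec_outcomeProj q₂ (outcomeProj O₁ *ᵥ (ψ 2).1.rep)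
    rw [one_smul] at h2
    have e : O₃ = -(O₁ * O₂) := by rw [h12, neg_neg]
    rw [e, Matrix.neg_mulVec, ← Matrix.mulVec_mulVec, h3, h2]
  have a1 := T.probFrom_append [] p₁ ε₁ l
  have a2 := T.probFrom_append [(p₁, ε₁)] p₂ ε₂ l
  have a3 := T.probFrom_append [(p₁, ε₁), (p₂, ε₂)] p₃ ε₃ l
  have a0 : T.probFrom [] l = 1 := rfl
  simp only [List.nil_append, List.cons_append] at a1 a2 a3
  -- Every branch of the tree of outcomes has probability zero, but they add up to `1`.
  linarith

/-- A set of more states than keys contains three states with a magic square. -/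
theorem exists_magicSquare (s : Finset (StabilizerState n))
    (hs : Fintype.card (FrameKey n) < s.card) :
    ∃ ψ : Fin 3 → StabilizerState n, Function.Injective ψ ∧ (∀ i, ψ i ∈ s) ∧
      CliffordEquivBasisGraphGraph (fun i => (ψ i).1) ∧
      ∃ A a B b : Op n, IsMagicSquare (fun i => (ψ i).1) A a B b := by
  obtain ⟨ψ₀, h₀⟩ : s.Nonempty := Finset.card_pos.1 (by omega)
  obtain ⟨U, hU, hU0⟩ := ψ₀.2.isStab_rep.exists_clifford
  choose κ hκ using fun ψ : StabilizerState n => (ψ.2.isStab_rep.mulVec hU).exists_key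
  -- One of the colliding states could a priori be `ψ₀`; `magicSquare_of_hasKey` excludes this, so
  -- all of `s` may enter the pigeonhole.
  obtain ⟨ψ₁, h₁, ψ₂, h₂, hne, he⟩ := Finset.exists_ne_map_eq_of_card_lt_of_maps_to
    (t := Finset.univ) (f := κ) (by rwa [Finset.card_univ]) fun _ _ => Finset.mem_univ _
  obtain ⟨hinj, hC, hM⟩ := magicSquare_of_hasKey (ψ := fun i => (![ψ₀, ψ₁, ψ₂] i).1) hU hU0
    (hκ ψ₁) (he ▸ hκ ψ₂) fun e => hne (Subtype.ext e)
  refine ⟨![ψ₀, ψ₁, ψ₂], fun i j hij => hinj (congrArg Subtype.val hij), fun i => ?_, hC, hM⟩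
  fin_cases i
  exacts [h₀, h₁, h₂]

end MagicSquare

end

theorem mainTheorem3 (n : ℕ) :
    (∀ s : Finset (MagicSquare.StabilizerState n),
      (2 : ℝ) ^ ((n : ℝ) ^ 2 / 4 + 7 * (n : ℝ) / 2) < (s.card : ℝ) →
        ∃ ψ : Fin 3 → MagicSquare.StabilizerState n,
          Function.Injective ψ ∧ (∀ i, ψ i ∈ s) ∧
          MagicSquare.CliffordEquivBasisGraphGraph (fun i => (ψ i).1) ∧
          ∃ A a B b : MagicSquare.Op n,
            MagicSquare.IsMagicSquare (fun i => (ψ i).1) A a B b) ∧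
    (∀ (Λ : Type*) [Fintype Λ] (T : MagicSquare.OntologicalTheory n Λ), T.Simulates →
      ∀ s : Finset (MagicSquare.StabilizerState n),
        (⋂ ψ ∈ s, T.supp ψ).Nonempty →
          (s.card : ℝ) ≤ (2 : ℝ) ^ ((n : ℝ) ^ 2 / 4 + 7 * (n : ℝ) / 2)) := by
  have h : ∀ s : Finset (MagicSquare.StabilizerState n),
      (2 : ℝ) ^ ((n : ℝ) ^ 2 / 4 + 7 * (n : ℝ) / 2) < (s.card : ℝ) →
        Fintype.card (MagicSquare.FrameKey n) < s.card := fun s hs =>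
    Nat.cast_lt.1 (MagicSquare.card_frameKey_le.trans_lt hs)
  refine ⟨fun s hs => MagicSquare.exists_magicSquare s (h s hs), fun Λ _ T hT s hl => ?_⟩
  by_contra! hs
  obtain ⟨l, hl⟩ := hl
  obtain ⟨ψ, -, hψ, -, A, a, B, b, hM⟩ := MagicSquare.exists_magicSquare s (h s hs)
  exact hM.disjoint_supp hT l fun i => Set.mem_iInter₂.1 hl (ψ i) (hψ i)
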